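/- A generalized Reedy category (Berger–Moerdijk) is a small category $\mathbb R$ with wide subcategories $\mathbb R^+$ (positive maps) and $\mathbb R^-$ (negative maps) and a degree function $\mathrm{Ob}(\mathbb R)\to\mathbb N$ such that: non-invertible maps of $\mathbb R^+$ (resp. $\mathbb R^-$) raise (resp. lower) the degree, and isomorphisms preserve it; $\mathbb R^+\cap\mathbb R^-$ is the class of isomorphisms; every map factors as a negative map followed by a positive map, uniquely up to isomorphism; and if $\theta f=f$ with $f$ in $\mathbb R^-$ and $\theta$ an automorphism, then $\theta$ is an identity. A Reedy functor is a functor preserving positive maps, negative maps and degree. For such $\mathbb R$ and $n\ge 0$, let $j_n\colon\mathbb G_n(\mathbb R)\to\mathbb R$ be the inclusion of the groupoid of objects of degree $n$ and isomorphisms. Let $\mathbb R^+((n))$ (resp. $\mathbb R^-((n))$) be the full subcategory of the arrow category of $\mathbb R^+$ (resp. $\mathbb R^-$) on the non-invertible maps whose codomain (resp. domain) has degree $n$. For $X\colon\mathbb R\to\mathbf{sSet}$ put $X_n=j_n^*X$, $L_nX=\mathrm{cod}_!\,\mathrm{dom}^*X$ and $M_nX=\mathrm{dom}_*\,\mathrm{cod}^*X$,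 diagrams on $\mathbb G_n(\mathbb R)$ (left and right Kan extensions along $\mathrm{cod}\colon\mathbb R^+((n))\to\mathbb G_n(\mathbb R)$ and $\mathrm{dom}\colon\mathbb R^-((n))\to\mathbb G_n(\mathbb R)$), with their natural maps $L_nX\to X_n\to M_nX$. A map $f\colon X\to Y$ in $\mathbf{sSet}^{\mathbb R}$ is a Reedy weak equivalence if it is levelwise a weak homotopy equivalence of simplicial sets; a Reedy cofibration if for every $n$ the relative latching map $X_n\amalg_{L_nX}L_nY\to Y_n$ is a projective cofibration in $\mathbf{sSet}^{\mathbb G_n(\mathbb R)}$ (i.e. has the left lifting property against all levelwise acyclic Kan fibrations); and a Reedy fibration if for every $n$ the relative matching map $X_n\to M_nX\times_{M_nY}Y_n$ is a levelwise Kan fibration. **Theorem.** Let $\phi\colon\mathbb S\to\mathbb R$ be a Reedy functor between generalized Reedy categories which is a discrete opfibration (for every object $s$ of $\mathbb S$ and map $f\colon\phi(s)\to r$ in $\mathbb R$ there is exactly one map $g$ of $\mathbb S$ with domain $s$ and $\phi(g)=f$). Suppose that $\phi$ reflects positive maps (every $f$ with $\phi(f)\in\mathbb R^+$ lies in $\mathbb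 S^+$), or that $\phi$ reflects negative maps (every $f$ with $\phi(f)\in\mathbb R^-$ lies in $\mathbb S^-$). Let $\phi_!\colon\mathbf{sSet}^{\mathbb S}\to\mathbf{sSet}^{\mathbb R}$ be left Kan extension along $\phi$. Then $\phi_!$ creates fibrations, cofibrations and weak equivalences: a map $g$ of $\mathbf{sSet}^{\mathbb S}$ is a Reedy fibration (resp. Reedy cofibration, Reedy weak equivalence) if and only if $\phi_!(g)$ is a Reedy fibration (resp. Reedy cofibration, Reedy weak equivalence) in $\mathbf{sSet}^{\mathbb R}$. -/

import Mathlib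

universe u

open CategoryTheory Limits HomotopicalAlgebra
open scoped SSet.modelCategoryQuillen

/-! ### Generalized Reedy categories and Reedy functors -/

/-- A generalized Reedy structure (Berger-Moerdijk) on a small category `R`: wide subcategories
of positive and negative maps and a degree function. -/
structure GeneralizedReedy (R : Type u) [SmallCategory R] where
  /-- the class of positive morphisms, the wide subcategory `R⁺` -/
  pos : MorphismProperty R
  /-- the class of negative morphisms, the wide subcategory `R⁻` -/
  neg : MorphismProperty R
  /-- the degree function -/
  deg : R → ℕ
  pos_mul : pos.IsMultiplicative
  neg_mul : neg.IsMultiplicative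
  /-- non-invertible positive maps raise the degree -/
  deg_lt_of_pos : ∀ {x y : R} (f : x ⟶ y), pos f → ¬ IsIso f → deg x < deg y
  /-- non-invertible negative maps lower the degree -/
  deg_lt_of_neg : ∀ {x y : R} (f : x ⟶ y), neg f → ¬ IsIso f → deg y < deg x
  /-- isomorphisms preserve the degree -/
  deg_eq_of_iso : ∀ {x y : R} (_ : x ≅ y), deg x = deg y
  /-- `R⁺ ∩ R⁻` is the class of isomorphisms -/
  pos_neg_iff : ∀ {x y : R} (f : x ⟶ y), (pos f ∧ neg f) ↔ IsIso f
  /-- every morphism is a negative map followed by a positive map -/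
  exists_fac : ∀ {x y : R} (f : x ⟶ y),
    ∃ (z : R) (h : x ⟶ z) (g : z ⟶ y), neg h ∧ pos g ∧ h ≫ g = f
  /-- such factorizations are unique up to isomorphism -/
  fac_unique : ∀ {x y z z' : R} (h : x ⟶ z) (g : z ⟶ y) (h' : x ⟶ z') (g' : z' ⟶ y),
    neg h → pos g → neg h' → pos g' → h ≫ g = h' ≫ g' →
      ∃ e : z ≅ z', h ≫ e.hom = h' ∧ e.hom ≫ g' = g
  /-- isomorphisms see negative maps as epimorphisms -/
  iso_eq_id : ∀ {x y : R} (f : x ⟶ y) (e : y ≅ y), neg f → f ≫ e.hom = f → e = Iso.refl y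

/-- A Reedy functor: a functor preserving positive maps, negative maps and the degree. -/
structure IsReedyFunctor {S R : Type u} [SmallCategory S] [SmallCategory R]
    (A : GeneralizedReedy S) (B : GeneralizedReedy R) (φ : S ⥤ R) : Prop where
  map_pos : ∀ {x y : S} (f : x ⟶ y), A.pos f → B.pos (φ.map f)
  map_neg : ∀ {x y : S} (f : x ⟶ y), A.neg f → B.neg (φ.map f)
  map_deg : ∀ x : S, B.deg (φ.obj x) = A.deg x

/-- A functor reflects the class `Q` of morphisms to the class `P`. -/
def ReflectsMaps {S R : Type u} [SmallCategory S] [SmallCategory R]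
    (P : MorphismProperty S) (Q : MorphismProperty R) (φ : S ⥤ R) : Prop :=
  ∀ ⦃x y : S⦄ (f : x ⟶ y), Q (φ.map f) → P f

/-- Discrete opfibration: for every object `s` of `S` and every morphism `f : φ s ⟶ r` there is
exactly one morphism `g` of `S` with domain `s` such that `φ g = f` (in particular the image of
the codomain of `g` is equal to `r`). -/
def IsDiscreteOpfibration {S R : Type u} [SmallCategory S] [SmallCategory R]
    (φ : S ⥤ R) : Prop :=
  ∀ (s : S) (f : Under (φ.obj s)), ∃! g : Under s, Under.mk (φ.map g.hom) = f

/-! ### Simplicial sets and the projective model structure -/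

/-- Weak homotopy equivalences of simplicial sets: precomposition with `f` induces, for each
Kan complex `K`, a surjection and an injection between sets of simplicial homotopy classes
`[Y, K] ⟶ [X, K]`. -/
def SSet.weakHomotopyEquivalences : MorphismProperty SSet.{u} :=
  fun X Y f => ∀ (K : SSet.{u}) [SSet.KanComplex K],
    (∀ g : X ⟶ K, ∃ h : Y ⟶ K, Nonempty (SSet.Homotopy (f ≫ h) g)) ∧
    (∀ h h' : Y ⟶ K, Nonempty (SSet.Homotopy (f ≫ h) (f ≫ h')) →
      Nonempty (SSet.Homotopy h h'))

/-- Levelwise weak equivalences of diagrams of simplicial sets. -/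
def levelwiseWeakEquivalences (C : Type u) [SmallCategory C] : MorphismProperty (C ⥤ SSet.{u}) :=
  SSet.weakHomotopyEquivalences.functorCategory C

/-- Projective fibrations of diagrams of simplicial sets: levelwise Kan fibrations. -/
def projectiveFibrations (C : Type u) [SmallCategory C] : MorphismProperty (C ⥤ SSet.{u}) :=
  (fibrations SSet.{u}).functorCategory C

/-- Projective cofibrations of diagrams of simplicial sets: maps with the left lifting property
against the projective fibrations that are levelwise weak equivalences. -/
def projectiveCofibrations (C : Type u) [SmallCategory C] : MorphismProperty (C ⥤ SSet.{u}) :=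
  (projectiveFibrations C ⊓ levelwiseWeakEquivalences C).llp

/-! ### Latching and matching objects, the Reedy classes -/

namespace GeneralizedReedy

attribute [instance] GeneralizedReedy.pos_mul GeneralizedReedy.neg_mul

variable {R : Type u} [SmallCategory R] (A : GeneralizedReedy R)

theorem isIso_of_pos {x y : R} (f : x ⟶ y) (hf : A.pos f) (h : A.deg x = A.deg y) :
    IsIso f := by
  by_contra hn
  exact (A.deg_lt_of_pos f hf hn).ne h

theorem isIso_of_neg {x y : R} (f : x ⟶ y) (hf : A.neg f) (h : A.deg x = A.deg y) :
    IsIso f := by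
  by_contra hn
  exact (A.deg_lt_of_neg f hf hn).ne h.symm

/-- The groupoid `𝔾ₙ(R)` of objects of degree `n` and isomorphisms of `R`. -/
abbrev Grpd (n : ℕ) : Type u :=
  ObjectProperty.FullSubcategory (C := Core R) (fun x => A.deg x.of = n)

/-- The inclusion `jₙ : 𝔾ₙ(R) ⥤ R`. -/
abbrev incl (n : ℕ) : A.Grpd n ⥤ R :=
  ObjectProperty.ι _ ⋙ Core.inclusion R

/-- `R⁺((n))`: the full subcategory of the arrow category of `R⁺` on the non-invertible positive
maps whose codomain has degree `n`. -/
abbrev PosArrow (n : ℕ) : Type u :=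
  ObjectProperty.FullSubcategory (C := Arrow (WideSubcategory A.pos))
    (fun a => ¬ IsIso a.hom.hom ∧ A.deg a.right.obj = n)

/-- `R⁻((n))`: the full subcategory of the arrow category of `R⁻` on the non-invertible negative
maps whose domain has degree `n`. -/
abbrev NegArrow (n : ℕ) : Type u :=
  ObjectProperty.FullSubcategory (C := Arrow (WideSubcategory A.neg))
    (fun a => ¬ IsIso a.hom.hom ∧ A.deg a.left.obj = n)

/-- The domain functor `R⁺((n)) ⥤ R`. -/
abbrev posDom (n : ℕ) : A.PosArrow n ⥤ R :=
  ObjectProperty.ι _ ⋙ Arrow.leftFunc ⋙ wideSubcategoryInclusion A.pos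

/-- The codomain functor `R⁻((n)) ⥤ R`. -/
abbrev negCod (n : ℕ) : A.NegArrow n ⥤ R :=
  ObjectProperty.ι _ ⋙ Arrow.rightFunc ⋙ wideSubcategoryInclusion A.neg

/-- The codomain functor `R⁺((n)) ⥤ 𝔾ₙ(R)`; positive maps between objects of the same degree
are invertible. -/
noncomputable def posCod (n : ℕ) : A.PosArrow n ⥤ A.Grpd n where
  obj a := ⟨⟨a.obj.right.obj⟩, a.property.2⟩
  map {a b} f := ObjectProperty.homMk ⟨@asIso _ _ _ _ f.hom.right.hom
    (A.isIso_of_pos _ f.hom.right.property (a.property.2.trans b.property.2.symm))⟩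
  map_id _ := by ext; rfl
  map_comp _ _ := by ext; rfl

/-- The domain functor `R⁻((n)) ⥤ 𝔾ₙ(R)`; negative maps between objects of the same degree
are invertible. -/
noncomputable def negDom (n : ℕ) : A.NegArrow n ⥤ A.Grpd n where
  obj a := ⟨⟨a.obj.left.obj⟩, a.property.2⟩
  map {a b} f := ObjectProperty.homMk ⟨@asIso _ _ _ _ f.hom.left.hom
    (A.isIso_of_neg _ f.hom.left.property (a.property.2.trans b.property.2.symm))⟩
  map_id _ := by ext; rfl
  map_comp _ _ := by ext; rfl

/-- The tautological transformation `dom ⟶ jₙ ∘ cod` on `R⁺((n))`. -/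
def posArrowHom (n : ℕ) : A.posDom n ⟶ A.posCod n ⋙ A.incl n where
  app a := a.obj.hom.hom
  naturality _ _ f := congrArg InducedWideCategory.Hom.hom f.hom.w

/-- The tautological transformation `jₙ ∘ dom ⟶ cod` on `R⁻((n))`. -/
def negArrowHom (n : ℕ) : A.negDom n ⋙ A.incl n ⟶ A.negCod n where
  app a := a.obj.hom.hom
  naturality _ _ f := congrArg InducedWideCategory.Hom.hom f.hom.w

/-- Restriction `X ↦ Xₙ = jₙ^* X`. -/
abbrev restr (n : ℕ) : (R ⥤ SSet.{u}) ⥤ (A.Grpd n ⥤ SSet.{u}) :=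
  (Functor.whiskeringLeft _ _ _).obj (A.incl n)

/-- The latching object functor `Lₙ = cod_! dom^*`. -/
noncomputable abbrev latching (n : ℕ) : (R ⥤ SSet.{u}) ⥤ (A.Grpd n ⥤ SSet.{u}) :=
  (Functor.whiskeringLeft _ _ _).obj (A.posDom n) ⋙ (A.posCod n).lan

/-- The matching object functor `Mₙ = dom_* cod^*`. -/
noncomputable abbrev matching (n : ℕ) : (R ⥤ SSet.{u}) ⥤ (A.Grpd n ⥤ SSet.{u}) :=
  (Functor.whiskeringLeft _ _ _).obj (A.negCod n) ⋙ (A.negDom n).ran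

/-- The latching map `Lₙ X ⟶ Xₙ`, the adjunct of `dom^* X ⟶ cod^* jₙ^* X`. -/
noncomputable def latchingMap (n : ℕ) (X : R ⥤ SSet.{u}) :
    (A.latching n).obj X ⟶ (A.restr n).obj X :=
  (((A.posCod n).lanAdjunction SSet.{u}).homEquiv (A.posDom n ⋙ X) (A.incl n ⋙ X)).symm
    (Functor.whiskerRight (A.posArrowHom n) X)

/-- The matching map `Xₙ ⟶ Mₙ X`, the adjunct of `dom^* jₙ^* X ⟶ cod^* X`. -/
noncomputable def matchingMap (n : ℕ) (X : R ⥤ SSet.{u}) :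
    (A.restr n).obj X ⟶ (A.matching n).obj X :=
  (((A.negDom n).ranAdjunction SSet.{u}).homEquiv (A.incl n ⋙ X) (A.negCod n ⋙ X))
    (Functor.whiskerRight (A.negArrowHom n) X)

theorem latchingMap_naturality (n : ℕ) {X Y : R ⥤ SSet.{u}} (f : X ⟶ Y) :
    A.latchingMap n X ≫ (A.restr n).map f = (A.latching n).map f ≫ A.latchingMap n Y := by
  have h1 := ((A.posCod n).lanAdjunction SSet.{u}).homEquiv_naturality_left_symm
    (Y := A.incl n ⋙ Y)
    (Functor.whiskerLeft (A.posDom n) f) (Functor.whiskerRight (A.posArrowHom n) Y)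
  have h2 := ((A.posCod n).lanAdjunction SSet.{u}).homEquiv_naturality_right_symm
    (Y := A.incl n ⋙ X) (Y' := A.incl n ⋙ Y)
    (Functor.whiskerRight (A.posArrowHom n) X) (Functor.whiskerLeft (A.incl n) f)
  refine h2.symm.trans (Eq.trans ?_ h1)
  congr 1
  ext a : 2
  exact f.naturality _

theorem matchingMap_naturality (n : ℕ) {X Y : R ⥤ SSet.{u}} (f : X ⟶ Y) :
    A.matchingMap n X ≫ (A.matching n).map f = (A.restr n).map f ≫ A.matchingMap n Y := by
  have h1 := ((A.negDom n).ranAdjunction SSet.{u}).homEquiv_naturality_left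
    (X := A.incl n ⋙ Y) (X' := A.incl n ⋙ X)
    (Functor.whiskerLeft (A.incl n) f) (Functor.whiskerRight (A.negArrowHom n) Y)
  have h2 := ((A.negDom n).ranAdjunction SSet.{u}).homEquiv_naturality_right
    (X := A.incl n ⋙ X)
    (Functor.whiskerRight (A.negArrowHom n) X) (Functor.whiskerLeft (A.negCod n) f)
  refine h2.symm.trans (Eq.trans ?_ h1)
  congr 1
  ext a : 2
  exact f.naturality _

/-- The relative latching map `ℓₙ(f) : Xₙ ⨿_{Lₙ X} Lₙ Y ⟶ Yₙ`. -/
noncomputable def relLatchingMap (n : ℕ) {X Y : R ⥤ SSet.{u}} (f : X ⟶ Y) :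
    pushout (A.latchingMap n X) ((A.latching n).map f) ⟶ (A.restr n).obj Y :=
  pushout.desc ((A.restr n).map f) (A.latchingMap n Y) (A.latchingMap_naturality n f)

/-- The relative matching map `mₙ(f) : Xₙ ⟶ Mₙ X ×_{Mₙ Y} Yₙ`. -/
noncomputable def relMatchingMap (n : ℕ) {X Y : R ⥤ SSet.{u}} (f : X ⟶ Y) :
    (A.restr n).obj X ⟶ pullback ((A.matching n).map f) (A.matchingMap n Y) :=
  pullback.lift (A.matchingMap n X) ((A.restr n).map f) (A.matchingMap_naturality n f)

/-- Reedy weak equivalences are the levelwise weak equivalences. -/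
def reedyWeakEquivalences (_ : GeneralizedReedy R) : MorphismProperty (R ⥤ SSet.{u}) :=
  levelwiseWeakEquivalences R

/-- Reedy cofibrations: all relative latching maps are projective cofibrations. -/
def reedyCofibrations : MorphismProperty (R ⥤ SSet.{u}) :=
  fun _ _ f => ∀ n : ℕ, projectiveCofibrations (A.Grpd n) (A.relLatchingMap n f)

/-- Reedy fibrations: all relative matching maps are projective fibrations. -/
def reedyFibrations : MorphismProperty (R ⥤ SSet.{u}) :=
  fun _ _ f => ∀ n : ℕ, projectiveFibrations (A.Grpd n) (A.relMatchingMap n f)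

end GeneralizedReedy

/-! Write `φ_!` for `φ.lan`. Since `φ` is a discrete opfibration, the fibre over `r` is final in the
category of objects over `r` (`final_fibreInclusion`), so `(φ_! X) r` is the coproduct of the `X s`
with `φ s = r`. Coproducts of simplicial sets are disjoint and extensive, and a simplex maps into a
single summand. Hence a coproduct of maps is a Kan fibration or a weak equivalence exactly when
every summand is, and the unit `X ⟶ φ^* φ_! X` is a monomorphism with cartesian naturality squares.
Weak equivalences are thereby settled levelwise.

Uniqueness of factorizations and preservation of degree make a Reedy functor reflect both positive
and negative maps. Together with unique lifting, this makes the comma categories that compute `jₙ^*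
φ_!`, `dom^* φ_!` and the matching objects at `s` equivalent to their counterparts at `φ s`.

For cofibrations, the resulting Guitart exact squares and adjunction identify lifting problems of
`ℓₙ(φ_! g)` against `p` with those of `ℓₙ(g)` against the restriction of `p` along `𝔾ₙ(φ)`
(`latchingLift_lan_iff`). Restriction preserves levelwise acyclic fibrations. Conversely `𝔾ₙ(φ)` is
again a discrete opfibration, so each acyclic fibration `p` on `𝔾ₙ(S)` is a pullback of the
restriction of the acyclic fibration `𝔾ₙ(φ)_! p`.

For fibrations, matching objects need not commute with coproducts, since their index categories may
be disconnected. The relative statement survives: in a horn lifting problem the simplex in `(φ_! Y)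
r` lies in one summand `Y s`, and cartesianness of the unit forces the remaining data into the
corresponding summands (`matchingLift_lan_iff`). -/

/-! ### Coproducts of simplicial sets -/

namespace SSet

open Simplicial Opposite MonoidalCategory

section Cofan

variable {I : Type u} {X : I → SSet.{u}} {c : Cofan X} (hc : IsColimit c)

/-- Coproducts of simplicial sets are computed levelwise. -/
noncomputable def isColimitCofanApp (k : SimplexCategoryᵒᵖ) :
    IsColimit (Cofan.mk (f := fun i => (X i).obj k) (c.pt.obj k) (fun i => (c.inj i).app k)) :=
  isColimitCofanMkObjOfIsColimit ((evaluation _ _).obj k) X c.inj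
    (hc.ofIsoColimit (Cofan.ext (Iso.refl _)))

include hc

theorem cofan_exists_app_eq {k : SimplexCategoryᵒᵖ} (x : c.pt.obj k) :
    ∃ (i : I) (y : (X i).obj k), (c.inj i).app k y = x :=
  Cofan.inj_jointly_surjective_of_isColimit (isColimitCofanApp hc k) x

theorem cofan_app_injective (i : I) (k : SimplexCategoryᵒᵖ) :
    Function.Injective ((c.inj i).app k) :=
  Cofan.inj_injective_of_isColimit (isColimitCofanApp hc k) i

theorem cofan_eq_of_app_eq {i j : I} {k : SimplexCategoryᵒᵖ} (x : (X i).obj k) (y : (X j).obj k)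
    (h : (c.inj i).app k x = (c.inj j).app k y) : i = j :=
  Cofan.eq_of_inj_apply_eq_of_isColimit (isColimitCofanApp hc k) x y h

/-- A map from a standard simplex to a coproduct factors through one of the summands. -/
theorem exists_stdSimplex_fac {n : ℕ} (b : Δ[n] ⟶ c.pt) :
    ∃ (i : I) (b' : Δ[n] ⟶ X i), b' ≫ c.inj i = b := by
  obtain ⟨i, y, hy⟩ := cofan_exists_app_eq hc (yonedaEquiv b)
  refine ⟨i, yonedaEquiv.symm y, ?_⟩
  rw [yonedaEquiv_symm_comp, hy, Equiv.symm_apply_apply]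

variable {Y : I → SSet.{u}} {d : Cofan Y} (hd : IsColimit d) (f : ∀ i, X i ⟶ Y i)
  (F : c.pt ⟶ d.pt) (hF : ∀ i, c.inj i ≫ F = f i ≫ d.inj i)

include hd hF

/-- Coproducts of simplicial sets are extensive. -/
theorem isPullback_cofan_inj (i : I) : IsPullback (c.inj i) (f i) F (d.inj i) := by
  apply IsPullback.of_forall_isPullback_app
  intro k
  rw [Types.isPullback_iff]
  refine ⟨congrArg (fun t => t.app k) (hF i), fun x y h => cofan_app_injective hc i k h.1, ?_⟩
  intro x y hxy
  obtain ⟨j, z, rfl⟩ := cofan_exists_app_eq hc x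
  have h1 : F.app k ((c.inj j).app k z) = (d.inj j).app k ((f j).app k z) :=
    ConcreteCategory.congr_hom (congrArg (fun t : X j ⟶ d.pt => t.app k) (hF j)) z
  have h2 := h1.symm.trans hxy
  -- The summands of `d` are disjoint and `F` respects the indexing, so `j = i`.
  obtain rfl := cofan_eq_of_app_eq hd _ _ h2
  exact ⟨z, rfl, cofan_app_injective hd _ _ h2⟩

/-- A coproduct of maps is a Kan fibration if and only if all the maps are Kan fibrations. -/
theorem fibrations_cofan_iff :
    fibrations SSet.{u} F ↔ ∀ i, fibrations SSet.{u} (f i) := by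
  constructor
  · intro h i
    rw [modelCategoryQuillen.fibrations_eq] at h ⊢
    exact MorphismProperty.of_isPullback (isPullback_cofan_inj hc hd f F hF i) h
  · intro h A B j hj
    simp only [modelCategoryQuillen.J, MorphismProperty.iSup_iff] at hj
    obtain ⟨n, ⟨i⟩⟩ := hj
    refine ⟨fun {a b} sq => ?_⟩
    -- The simplex lands in one summand, and the cartesian square `hp` then pulls the horn into the
    -- summand with the same index.
    obtain ⟨l, b, rfl⟩ := exists_stdSimplex_fac hd b
    have hp := isPullback_cofan_inj hc hd f F hF l
    have := h l _ (modelCategoryQuillen.horn_ι_mem_J (n + 1) i)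
    have sq' : CommSq (hp.lift a (Subcomplex.ι _ ≫ b) (by simpa using sq.w))
      (Subcomplex.ι _) (f l) b := ⟨by simp⟩
    exact ⟨⟨⟨sq'.lift ≫ c.inj l, by simp, by rw [Category.assoc, hF]; simp⟩⟩⟩

end Cofan

/-! ### Homotopies and weak homotopy equivalences -/

theorem nonempty_homotopy_iff {X Y : SSet.{u}} (f g : X ⟶ Y) :
    Nonempty (Homotopy f g) ↔ ∃ h : X ⊗ Δ[1] ⟶ Y, ι₀ ≫ h = f ∧ ι₁ ≫ h = g :=
  ⟨fun ⟨H⟩ => ⟨H.h, H.h₀, H.h₁⟩, fun ⟨h, h₀, h₁⟩ => ⟨{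
    h := h
    h₀ := h₀
    h₁ := h₁
    -- The homotopy is relative to the empty subcomplex, so this condition is vacuous.
    rel := by
      ext k ⟨⟨_, h⟩, _⟩
      exact h.elim }⟩⟩

theorem Homotopy.nonempty_refl {X Y : SSet.{u}} (f : X ⟶ Y) : Nonempty (Homotopy f f) :=
  ⟨RelativeMorphism.Homotopy.refl _⟩

theorem Homotopy.nonempty_precomp {X Y Z : SSet.{u}} {f g : Y ⟶ Z} (h : Nonempty (Homotopy f g))
    (e : X ⟶ Y) : Nonempty (Homotopy (e ≫ f) (e ≫ g)) := by
  rw [nonempty_homotopy_iff] at h ⊢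
  obtain ⟨h, h₀, h₁⟩ := h
  exact ⟨e ▷ _ ≫ h, by rw [← h₀]; rfl, by rw [← h₁]; rfl⟩

/-- Homotopies out of a coproduct are given on the summands. -/
theorem nonempty_homotopy_cofan {I : Type u} {X : I → SSet.{u}} {c : Cofan X} (hc : IsColimit c)
    {K : SSet.{u}} (f g : c.pt ⟶ K)
    (h : ∀ i, Nonempty (Homotopy (c.inj i ≫ f) (c.inj i ≫ g))) : Nonempty (Homotopy f g) := by
  simp only [nonempty_homotopy_iff] at h ⊢
  choose h h₀ h₁ using h
  -- Tensoring with `Δ[1]` preserves coproducts, so homotopies on the summands glue.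
  have hc' := isColimitCofanMkObjOfIsColimit (tensorRight Δ[1]) X c.inj
    (hc.ofIsoColimit (Cofan.ext (Iso.refl _)))
  refine ⟨Cofan.IsColimit.desc hc' h, Cofan.IsColimit.hom_ext hc _ _ fun i => ?_,
    Cofan.IsColimit.hom_ext hc _ _ fun i => ?_⟩
  · rw [← h₀, ← Cofan.IsColimit.fac hc' h i]; rfl
  · rw [← h₁, ← Cofan.IsColimit.fac hc' h i]; rfl


/-! ### Discrete simplicial sets as Kan complexes separating points -/

section Discrete

variable (T : Type u)

/-- The discrete simplicial set on a type. -/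
abbrev discrete : SSet.{u} := (Functor.const _).obj T

/-- Two faces of a horn share a common face, and face maps act as identities on a constant
simplicial set, so all faces of a compatible horn name the same element. A horn in `Δ[1]` has only
one face. -/
instance kanComplex_discrete : KanComplex (discrete T) := by
  rw [KanComplex.iff]
  intro n i f hf
  obtain ⟨t, ht⟩ : ∃ t : T, ∀ j hj, yonedaEquiv (f j hj) = t := by
    obtain _ | n := n
    · obtain ⟨j, hj⟩ := exists_ne i
      refine ⟨yonedaEquiv (f j hj), fun k hk => ?_⟩
      obtain rfl : k = j := by lia
      rfl
    · have key (j k hj hk) (hjk : j < k) : yonedaEquiv (f j hj) = yonedaEquiv (f k hk) := by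
        have h := congrArg yonedaEquiv ((horn.isCompatible_iff f).1 hf j k hj hk hjk)
        have h' (l) (e : Δ[n + 1] ⟶ discrete T) :
            yonedaEquiv (stdSimplex.δ l ≫ e) = yonedaEquiv e := by
          obtain ⟨x, rfl⟩ := yonedaEquiv.symm.surjective e
          rfl
        rwa [h', h'] at h
      obtain ⟨j, hj⟩ := exists_ne i
      refine ⟨yonedaEquiv (f j hj), fun k hk => ?_⟩
      obtain h | rfl | h := lt_trichotomy j k
      · exact (key _ _ _ _ h).symm
      · rfl
      · exact key _ _ _ _ h
  refine ⟨yonedaEquiv.symm t, fun j hj => yonedaEquiv.injective ?_⟩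
  rw [ht]
  rfl

variable {T}

/-- At the vertex `x` the homotopy is an edge of a constant simplicial set, whose two ends coincide.
-/
theorem eq_of_homotopy_const {X : SSet.{u}} (x : X _⦋0⦌) (t t' : T)
    (H : Homotopy (const (X := X) (Y := discrete T) t) (const t')) : t = t' := by
  have H := H.toSimplicialObjectHomotopy
  have h₀ := ConcreteCategory.congr_hom (H.h_zero_comp_δ_zero 0) x
  have h₁ := ConcreteCategory.congr_hom (H.h_last_comp_δ_last 0) x
  exact h₁.symm.trans h₀

end Discrete

/-- Every simplex has a vertex, so without vertices there are no simplices at all. -/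
theorem hom_ext_of_isEmpty {X Y : SSet.{u}} (hX : IsEmpty (X _⦋0⦌)) (f g : X ⟶ Y) : f = g := by
  ext k x
  exact (hX.false (X.map (SimplexCategory.const ⦋0⦌ k.unop 0).op x)).elim

theorem exists_hom_of_isEmpty {X : SSet.{u}} (hX : IsEmpty (X _⦋0⦌)) (Y : SSet.{u}) :
    Nonempty (X ⟶ Y) := by
  have h (k) (x : X.obj k) : False := hX.false (X.map (SimplexCategory.const ⦋0⦌ k.unop 0).op x)
  exact ⟨{ app k := ↾fun x => (h k x).elim
           naturality k l f := by ext x; exact (h k x).elim }⟩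

/-! ### Weak homotopy equivalences between coproducts -/

section WeakEquivalence

variable {I : Type u} {X : I → SSet.{u}} {c : Cofan X} (hc : IsColimit c)
  {Y : I → SSet.{u}} {d : Cofan Y} (hd : IsColimit d) (f : ∀ i, X i ⟶ Y i)
  (F : c.pt ⟶ d.pt) (hF : ∀ i, c.inj i ≫ F = f i ≫ d.inj i)

include hc hd hF

theorem weakHomotopyEquivalences_cofan (hf : ∀ i, weakHomotopyEquivalences (f i)) :
    weakHomotopyEquivalences F := by
  intro K _
  refine ⟨fun g => ?_, fun h h' H => ?_⟩
  · choose h hh using fun i => (hf i K).1 (c.inj i ≫ g)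
    refine ⟨Cofan.IsColimit.desc hd h, nonempty_homotopy_cofan hc _ _ fun i => ?_⟩
    rw [reassoc_of% hF, Cofan.IsColimit.fac]
    exact hh i
  · refine nonempty_homotopy_cofan hd _ _ fun i => (hf i K).2 _ _ ?_
    rw [← reassoc_of% hF, ← reassoc_of% hF]
    exact Homotopy.nonempty_precomp H _

-- `g` is extended to the whole coproduct by the constant map at `t` on the other summands; the
-- vertex is what makes this extension available.
omit hd in
open Classical in
theorem exists_homotopy_of_cofan_of_vertex (H : weakHomotopyEquivalences F) (i : I)
    (K : SSet.{u}) [KanComplex K] (t : K _⦋0⦌) (g : X i ⟶ K) :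
    ∃ h : Y i ⟶ K, Nonempty (Homotopy (f i ≫ h) g) := by
  obtain ⟨h, hh⟩ :=
    (H K).1 (Cofan.IsColimit.desc hc (Function.update (fun _ => const t) i g))
  refine ⟨d.inj i ≫ h, ?_⟩
  simpa [reassoc_of% hF] using Homotopy.nonempty_precomp hh (c.inj i)

-- `h` and `h'` are both extended by the same constant map, so that they can differ only on the
-- summand `i`, where they are homotopic after composition with `f i`.
open Classical in
theorem homotopy_of_cofan_of_vertex (H : weakHomotopyEquivalences F) (i : I)
    (K : SSet.{u}) [KanComplex K] (t : K _⦋0⦌) (h h' : Y i ⟶ K)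
    (hh : Nonempty (Homotopy (f i ≫ h) (f i ≫ h'))) : Nonempty (Homotopy h h') := by
  have := (H K).2 (Cofan.IsColimit.desc hd (Function.update (fun _ => const t) i h))
    (Cofan.IsColimit.desc hd (Function.update (fun _ => const t) i h'))
    (nonempty_homotopy_cofan hc _ _ fun j => by
      rw [reassoc_of% hF, reassoc_of% hF, Cofan.IsColimit.fac, Cofan.IsColimit.fac]
      obtain rfl | hj := eq_or_ne j i
      · simpa using hh
      · simpa [hj] using Homotopy.nonempty_refl _)
  simpa using Homotopy.nonempty_precomp this (d.inj i)

/-- A coproduct of maps is a weak homotopy equivalence if and only if all the maps are. -/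
theorem weakHomotopyEquivalences_cofan_iff :
    weakHomotopyEquivalences F ↔ ∀ i, weakHomotopyEquivalences (f i) := by
  refine ⟨fun H i K _ => ⟨fun g => ?_, fun h h' hh => ?_⟩,
    weakHomotopyEquivalences_cofan hc hd f F hF⟩
  -- A vertex of `K` is obtained as the image of a vertex of the source; empty summands are treated
  -- apart.
  · obtain hX | ⟨⟨x⟩⟩ := isEmpty_or_nonempty (X i _⦋0⦌)
    · obtain hY | ⟨⟨y⟩⟩ := isEmpty_or_nonempty (Y i _⦋0⦌)
      · obtain ⟨h⟩ := exists_hom_of_isEmpty hY K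
        refine ⟨h, ?_⟩
        rw [hom_ext_of_isEmpty hX (f i ≫ h) g]
        exact Homotopy.nonempty_refl _
      -- An empty `X i` with `Y i` inhabited is impossible: the constant maps at two distinct points
      -- of `D` agree on `X i`, hence would be homotopic on `Y i`.
      · let D : SSet.{u} := discrete (ULift Bool)
        obtain ⟨E⟩ := homotopy_of_cofan_of_vertex hc hd f F hF H i D (ULift.up true)
          (const (ULift.up true)) (const (ULift.up false)) (by
            rw [hom_ext_of_isEmpty hX (f i ≫ const (Y := D) (ULift.up true))
              (f i ≫ const (ULift.up false))]
            exact Homotopy.nonempty_refl _)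
        simpa using eq_of_homotopy_const y _ _ E
    · exact exists_homotopy_of_cofan_of_vertex hc f F hF H i K (g.app _ x) g
  · obtain hY | ⟨⟨y⟩⟩ := isEmpty_or_nonempty (Y i _⦋0⦌)
    · rw [hom_ext_of_isEmpty hY h h']
      exact Homotopy.nonempty_refl _
    · exact homotopy_of_cofan_of_vertex hc hd f F hF H i K (h.app _ y) h h' hh

end WeakEquivalence

end SSet

/-! ### Discrete opfibrations -/

/-- Unique lifts are given as equalities of objects under a fixed one; this converts them into
equations between morphisms. -/
theorem CategoryTheory.Under.mk_eq_mk_iff {C : Type*} [Category* C] {x y z : C}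
    (f : x ⟶ y) (g : x ⟶ z) : Under.mk f = Under.mk g ↔ ∃ e : y = z, f ≫ eqToHom e = g := by
  constructor
  · intro h
    have key (w : Under x) (h : Under.mk f = w) :
        ∃ e : y = w.right, f ≫ eqToHom e = w.hom := by
      subst h
      exact ⟨rfl, by simp⟩
    exact key _ h
  · rintro ⟨rfl, rfl⟩
    simp

namespace IsDiscreteOpfibration

variable {S R : Type u} [SmallCategory S] [SmallCategory R] {φ : S ⥤ R}
  (h : IsDiscreteOpfibration φ)

include h

/-- To prove a statement about all maps out of `φ s`, it suffices to consider images of maps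
out of `s`. -/
theorem induction_on {s : S} {motive : ∀ r, (φ.obj s ⟶ r) → Prop}
    (H : ∀ s' (g : s ⟶ s'), motive _ (φ.map g)) {r : R} (f : φ.obj s ⟶ r) : motive r f := by
  obtain ⟨g, hg, _⟩ := h s (Under.mk f)
  have key (w : Under (φ.obj s)) (hw : w = Under.mk f) (hm : motive w.right w.hom) :
      motive r f := by
    subst hw
    exact hm
  exact key _ hg (H _ g.hom)

theorem eq_of_map_eq {s t t' : S} (g : s ⟶ t) (g' : s ⟶ t')
    (hg : Under.mk (φ.map g) = Under.mk (φ.map g')) : Under.mk g = Under.mk g' :=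
  (h s _).unique hg rfl

theorem faithful : φ.Faithful where
  map_injective {s t} f g hfg := by
    simpa using (Under.mk_eq_mk_iff _ _).1 (h.eq_of_map_eq f g (by rw [hfg]))

/-- Maps under `φ s` between images of objects under `s` lift. -/
theorem exists_lift {s t v : S} (u : s ⟶ t) (u' : s ⟶ v) (m : φ.obj t ⟶ φ.obj v)
    (hm : φ.map u ≫ m = φ.map u') : ∃ g : t ⟶ v, φ.map g = m ∧ u ≫ g = u' := by
  obtain ⟨g, hg, _⟩ := h t (Under.mk m)
  -- With `g` the lift of `m` from `t`, the maps `u ≫ g.hom` and `u'` start at `s` and have the same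
  -- image, so unique lifting identifies them, including their codomains.
  have h₁ : Under.mk (φ.map (u ≫ g.hom)) = Under.mk (φ.map u') := by
    rw [← hm, φ.map_comp]
    exact congrArg (fun w : Under (φ.obj t) => Under.mk (φ.map u ≫ w.hom)) hg
  obtain ⟨e, he⟩ := (Under.mk_eq_mk_iff _ _).1 (h.eq_of_map_eq _ _ h₁)
  obtain ⟨e', he'⟩ := (Under.mk_eq_mk_iff _ _).1 hg
  exact ⟨g.hom ≫ eqToHom e, by rw [φ.map_comp, ← he', eqToHom_map], by rw [← he, Category.assoc]⟩

/-- Supplies fullness of the comparison functors for arrow categories: `m` is lifted under `s`, then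
`m'` under `x`. -/
theorem exists_square_lift {s x x' y y' : S} (u : s ⟶ x) (v : s ⟶ y) (p : x ⟶ x') (q : y ⟶ y')
    (m : φ.obj x ⟶ φ.obj y) (m' : φ.obj x' ⟶ φ.obj y') (hm : φ.map u ≫ m = φ.map v)
    (hm' : m ≫ φ.map q = φ.map p ≫ m') :
    ∃ (g : x ⟶ y) (k : x' ⟶ y'), φ.map g = m ∧ φ.map k = m' ∧ u ≫ g = v ∧ g ≫ q = p ≫ k := by
  obtain ⟨g, rfl, hu⟩ := h.exists_lift u v m hm
  obtain ⟨k, rfl, hk⟩ := h.exists_lift p (g ≫ q) m' (by rw [φ.map_comp, hm'])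
  exact ⟨g, k, rfl, rfl, hu, hk.symm⟩

/-- The inverse of `φ.map f` is lifted as a map under the domain of `f`. This gives one inverse law;
faithfulness gives the other. -/
theorem reflectsIsomorphisms : φ.ReflectsIsomorphisms where
  reflects {s t} f _ := by
    obtain ⟨g, hg, hfg⟩ := h.exists_lift f (𝟙 s) (inv (φ.map f)) (by simp)
    exact ⟨g, hfg, h.faithful.map_injective (by simp [hg])⟩

/-! ### Left Kan extension along a discrete opfibration -/

/-- The inclusion of the fibre over `r` in the category of objects over `r`. -/
abbrev _root_.CategoryTheory.Functor.fibreInclusion (φ : S ⥤ R) (r : R) :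
    Discrete { s : S // φ.obj s = r } ⥤ CostructuredArrow φ r :=
  Discrete.functor fun s => CostructuredArrow.mk (eqToHom s.2)

/-- An object `f : φ s ⟶ r` maps to the fibre only through the unique lift of `f`, so the category
to be shown connected has a single object. -/
theorem final_fibreInclusion (r : R) : (φ.fibreInclusion r).Final where
  out d := by
    obtain ⟨s, f, rfl⟩ := d.mk_surjective
    induction f using h.induction_on with
    | _ s' g =>
      let κ : CostructuredArrow.mk (φ.map g) ⟶
          (φ.fibreInclusion (φ.obj s')).obj ⟨⟨s', rfl⟩⟩ := CostructuredArrow.homMk g (by simp)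
      let b : StructuredArrow (CostructuredArrow.mk (φ.map g)) (φ.fibreInclusion (φ.obj s')) :=
        StructuredArrow.mk κ
      have hb (x) : x = b := by
        obtain ⟨⟨⟨s'', e⟩⟩, κ, rfl⟩ := StructuredArrow.mk_surjective x
        obtain ⟨k, hk, rfl⟩ := CostructuredArrow.homMk_surjective κ
        change s ⟶ s'' at k
        obtain ⟨e', he⟩ := (Under.mk_eq_mk_iff _ _).1 (h.eq_of_map_eq k g
          ((Under.mk_eq_mk_iff _ _).2 ⟨e, hk⟩))
        subst e'
        obtain rfl : k = g := by simpa using he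
        rfl
      have : Nonempty (StructuredArrow (CostructuredArrow.mk (φ.map g))
        (φ.fibreInclusion (φ.obj s'))) := ⟨b⟩
      refine zigzag_isConnected fun x y => ?_
      rw [hb x, hb y]

omit h in
/-- The values of the left Kan extension as cofans over the fibres. -/
noncomputable def _root_.CategoryTheory.Functor.lanCofan (φ : S ⥤ R) (X : S ⥤ SSet.{u}) (r : R) :
    Cofan (fun s : { s : S // φ.obj s = r } => X.obj s.1) :=
  Cofan.mk ((φ.lan.obj X).obj r)
    (fun s => (φ.lanUnit.app X).app s.1 ≫ (φ.lan.obj X).map (eqToHom s.2))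

omit h in
theorem _root_.CategoryTheory.Functor.lanCofan_inj_comp (φ : S ⥤ R) {X Y : S ⥤ SSet.{u}}
    (g : X ⟶ Y) (r : R) (s : { s : S // φ.obj s = r }) :
    (φ.lanCofan X r).inj s ≫ (φ.lan.map g).app r = g.app s.1 ≫ (φ.lanCofan Y r).inj s := by
  have := congrArg (fun t => t.app s.1) (φ.lanUnit.naturality g)
  dsimp at this
  simp only [Functor.lanCofan, Cofan.inj, Cofan.mk_ι_app, Category.assoc, NatTrans.naturality]
  rw [reassoc_of% this]

/-- Left Kan extension along a discrete opfibration is given by coproducts over the fibres. -/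
noncomputable def isColimitLanCofan (X : S ⥤ SSet.{u}) (r : R) :
    IsColimit (φ.lanCofan X r) := by
  have := h.final_fibreInclusion r
  have hc := (Functor.Final.isColimitWhiskerEquiv (φ.fibreInclusion r) _).symm
    (φ.isPointwiseLeftKanExtensionLeftKanExtensionUnit X r)
  refine IsColimit.ofIsoColimit ((IsColimit.precomposeHomEquiv
    (Discrete.natIso fun s => Iso.refl (X.obj s.as.1)) _).symm hc)
    (Cocone.ext (Iso.refl _) ?_)
  intro s
  simp only [Functor.lanCofan, Functor.lanUnit, Functor.lan]
  exact (Category.comp_id _).trans (Category.id_comp _)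

/-- The unit of the adjunction for left Kan extension along a discrete opfibration is
cartesian. -/
theorem isPullback_lanUnit_app {X Y : S ⥤ SSet.{u}} (g : X ⟶ Y) (s : S) :
    IsPullback ((φ.lanUnit.app X).app s) (g.app s) ((φ.lan.map g).app (φ.obj s))
      ((φ.lanUnit.app Y).app s) := by
  simpa [Functor.lanCofan, Cofan.inj] using SSet.isPullback_cofan_inj (h.isColimitLanCofan X (φ.obj s))
    (h.isColimitLanCofan Y (φ.obj s)) _ _ (φ.lanCofan_inj_comp g _) ⟨s, rfl⟩

theorem mono_lanUnit_app (X : S ⥤ SSet.{u}) (s : S) : Mono ((φ.lanUnit.app X).app s) := by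
  have hk (k) : Mono (((φ.lanUnit.app X).app s).app k) := by
    rw [mono_iff_injective]
    have := SSet.cofan_app_injective (h.isColimitLanCofan X (φ.obj s)) ⟨s, rfl⟩ k
    simp only [Functor.lanCofan, Cofan.inj, Cofan.mk_ι_app, eqToHom_refl,
      CategoryTheory.Functor.map_id] at this
    exact this
  exact NatTrans.mono_of_mono_app _

open Simplicial in
-- Stated as an induction principle with `r` varying, so that the equation `φ.obj s = r` of the
-- chosen summand can be substituted.
theorem exists_stdSimplex_fac (X : S ⥤ SSet.{u}) {n : ℕ}
    {motive : ∀ r, (Δ[n] ⟶ (φ.lan.obj X).obj r) → Prop}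
    (H : ∀ s (b : Δ[n] ⟶ X.obj s), motive _ (b ≫ (φ.lanUnit.app X).app s))
    {r : R} (b : Δ[n] ⟶ (φ.lan.obj X).obj r) : motive r b := by
  obtain ⟨⟨s, rfl⟩, b, rfl⟩ := SSet.exists_stdSimplex_fac (h.isColimitLanCofan X r) b
  simpa [Functor.lanCofan, Cofan.inj] using H s b

theorem fibrations_lan_map {X Y : S ⥤ SSet.{u}} (g : X ⟶ Y)
    (hg : projectiveFibrations S g) : projectiveFibrations R (φ.lan.map g) := fun r =>
  (SSet.fibrations_cofan_iff (h.isColimitLanCofan X r) (h.isColimitLanCofan Y r) _ _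
    (φ.lanCofan_inj_comp g r)).2 fun s => hg s.1

theorem weakEquivalences_lan_map_iff {X Y : S ⥤ SSet.{u}} (g : X ⟶ Y) :
    levelwiseWeakEquivalences R (φ.lan.map g) ↔ levelwiseWeakEquivalences S g := by
  have key (r) := SSet.weakHomotopyEquivalences_cofan_iff (h.isColimitLanCofan X r)
    (h.isColimitLanCofan Y r) _ _ (φ.lanCofan_inj_comp g r)
  exact ⟨fun hg s => (key (φ.obj s)).1 (hg _) ⟨s, rfl⟩, fun hg r => (key r).2 fun s => hg s.1⟩

end IsDiscreteOpfibration

/-! ### Functors induced by a Reedy functor -/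

namespace IsReedyFunctor

variable {S R : Type u} [SmallCategory S] [SmallCategory R] {A : GeneralizedReedy S}
  {B : GeneralizedReedy R} {φ : S ⥤ R} (hφ : IsReedyFunctor A B φ)

include hφ

/-- `φ` preserves degrees and isomorphisms of `R` do too, so `f` is positive between objects of
equal degree. -/
theorem isIso_of_pos {x y : S} (f : x ⟶ y) (hf : A.pos f) (h : IsIso (φ.map f)) : IsIso f :=
  A.isIso_of_pos f hf (by rw [← hφ.map_deg, ← hφ.map_deg, B.deg_eq_of_iso (asIso (φ.map f))])

theorem isIso_of_neg {x y : S} (f : x ⟶ y) (hf : A.neg f) (h : IsIso (φ.map f)) : IsIso f :=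
  A.isIso_of_neg f hf (by rw [← hφ.map_deg, ← hφ.map_deg, B.deg_eq_of_iso (asIso (φ.map f))])

/-- Reedy functors reflect positive maps. -/
theorem reflects_pos {x y : S} (f : x ⟶ y) (hf : B.pos (φ.map f)) : A.pos f := by
  obtain ⟨z, h, g, hh, hg, rfl⟩ := A.exists_fac f
  -- The positive map `φ.map (h ≫ g)` also has the factorization with trivial negative part;
  -- comparing the two makes `φ.map h` invertible.
  obtain ⟨e, he, -⟩ := B.fac_unique (𝟙 _) (φ.map (h ≫ g)) (φ.map h) (φ.map g)
    (B.neg.id_mem _) hf (hφ.map_neg h hh) (hφ.map_pos g hg) (by simp)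
  have : IsIso h := hφ.isIso_of_neg h hh (by rw [← he]; infer_instance)
  exact A.pos.comp_mem _ _ ((A.pos_neg_iff h).2 this).1 hg

/-- Reedy functors reflect negative maps. -/
theorem reflects_neg {x y : S} (f : x ⟶ y) (hf : B.neg (φ.map f)) : A.neg f := by
  obtain ⟨z, h, g, hh, hg, rfl⟩ := A.exists_fac f
  -- Dually, comparison with the factorization having trivial positive part makes `φ.map g`
  -- invertible.
  obtain ⟨e, -, he⟩ := B.fac_unique (φ.map h) (φ.map g) (φ.map (h ≫ g)) (𝟙 _)
    (hφ.map_neg h hh) (hφ.map_pos g hg) hf (B.pos.id_mem _) (by simp)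
  have : IsIso g := hφ.isIso_of_pos g hg (by rw [← he]; infer_instance)
  exact A.neg.comp_mem _ _ hh ((A.pos_neg_iff g).2 this).2

variable (n : ℕ)

/-- The functor induced on groupoids of objects of degree `n`. -/
def mapGrpd : A.Grpd n ⥤ B.Grpd n where
  obj x := ⟨⟨φ.obj x.obj.of⟩, (hφ.map_deg _).trans x.property⟩
  map f := ObjectProperty.homMk ⟨φ.mapIso f.hom.iso⟩
  map_id _ := by ext; exact φ.map_id _
  map_comp _ _ := by ext; exact φ.map_comp _ _

/-- The functor induced on non-invertible positive maps with codomain of degree `n`. -/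
def mapPos : A.PosArrow n ⥤ B.PosArrow n where
  obj a := ⟨Arrow.mk (X := ⟨φ.obj a.obj.left.obj⟩) (Y := ⟨φ.obj a.obj.right.obj⟩)
    ⟨φ.map a.obj.hom.hom, hφ.map_pos _ a.obj.hom.property⟩,
    fun h => a.property.1 (hφ.isIso_of_pos _ a.obj.hom.property h),
    (hφ.map_deg _).trans a.property.2⟩
  map f := ObjectProperty.homMk (Arrow.homMk
    ⟨φ.map f.hom.left.hom, hφ.map_pos _ f.hom.left.property⟩
    ⟨φ.map f.hom.right.hom, hφ.map_pos _ f.hom.right.property⟩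
    (by
      ext
      have h := congrArg InducedWideCategory.Hom.hom f.hom.w
      exact (φ.map_comp _ _).symm.trans ((congrArg (fun t => φ.map t) h).trans (φ.map_comp _ _))))
  map_id _ := by ext <;> exact φ.map_id _
  map_comp _ _ := by ext <;> exact φ.map_comp _ _

/-- The functor induced on non-invertible negative maps with domain of degree `n`. -/
def mapNeg : A.NegArrow n ⥤ B.NegArrow n where
  obj a := ⟨Arrow.mk (X := ⟨φ.obj a.obj.left.obj⟩) (Y := ⟨φ.obj a.obj.right.obj⟩)
    ⟨φ.map a.obj.hom.hom, hφ.map_neg _ a.obj.hom.property⟩,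
    fun h => a.property.1 (hφ.isIso_of_neg _ a.obj.hom.property h),
    (hφ.map_deg _).trans a.property.2⟩
  map f := ObjectProperty.homMk (Arrow.homMk
    ⟨φ.map f.hom.left.hom, hφ.map_neg _ f.hom.left.property⟩
    ⟨φ.map f.hom.right.hom, hφ.map_neg _ f.hom.right.property⟩
    (by
      ext
      have h := congrArg InducedWideCategory.Hom.hom f.hom.w
      exact (φ.map_comp _ _).symm.trans ((congrArg (fun t => φ.map t) h).trans (φ.map_comp _ _))))
  map_id _ := by ext <;> exact φ.map_id _
  map_comp _ _ := by ext <;> exact φ.map_comp _ _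

/-- The square relating the inclusions of the groupoids of objects of degree `n`. -/
def inclSquare : TwoSquare (A.incl n) (hφ.mapGrpd n) φ (B.incl n) := 𝟙 (A.incl n ⋙ φ)

/-- The square relating the domain functors on positive maps. -/
def posSquare : TwoSquare (A.posDom n) (hφ.mapPos n) φ (B.posDom n) := 𝟙 (A.posDom n ⋙ φ)

/-- The square relating the domain functors on negative maps. -/
noncomputable def negSquare : TwoSquare (A.negDom n) (hφ.mapNeg n) (hφ.mapGrpd n) (B.negDom n) where
  app a := 𝟙 _
  naturality a b f := by ext; exact (Category.comp_id _).trans (Category.id_comp _).symm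

/-- The functors induced by `φ` are compatible with codomains of positive maps. -/
noncomputable def mapPosCompPosCod : hφ.mapPos n ⋙ B.posCod n ≅ A.posCod n ⋙ hφ.mapGrpd n :=
  NatIso.ofComponents (fun _ => Iso.refl _) fun _ => by
    ext; exact (Category.comp_id _).trans (Category.id_comp _).symm

variable {n}

/-- The unique lift of an isomorphism is invertible because `φ` reflects isomorphisms, and its
codomain has degree `n` because `φ` preserves degrees. -/
theorem isDiscreteOpfibration_mapGrpd (hopf : IsDiscreteOpfibration φ) :
    IsDiscreteOpfibration (hφ.mapGrpd n) := by
  have := hopf.reflectsIsomorphisms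
  intro s f
  -- The underlying morphism `m` is separated from the isomorphism `e` so that `induction_on` can
  -- replace it, with its codomain, by an image.
  have key : ∀ (r : R) (m : φ.obj s.obj.of ⟶ r) (e : φ.obj s.obj.of ≅ r) (_ : e.hom = m)
      (hr : B.deg r = n), ∃! g : Under s, Under.mk ((hφ.mapGrpd n).map g.hom) =
        Under.mk (Y := (⟨⟨r⟩, hr⟩ : B.Grpd n)) (ObjectProperty.homMk ⟨e⟩) := by
    intro r m
    induction m using hopf.induction_on with
    | H s' g =>
      intro e he hr
      have hg : IsIso g := by
        have : IsIso (φ.map g) := by rw [← he]; infer_instance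
        exact isIso_of_reflects_iso g φ
      obtain rfl : e = φ.mapIso (asIso g) := by ext; exact he
      let t : A.Grpd n := ⟨⟨s'⟩, (hφ.map_deg s').symm.trans hr⟩
      let k : s ⟶ t := ObjectProperty.homMk ⟨asIso g⟩
      refine ⟨Under.mk k, rfl, ?_⟩
      rintro y hy
      obtain ⟨⟨⟨y⟩, hy'⟩, l, rfl⟩ : ∃ (t : A.Grpd n) (l : s ⟶ t), y = Under.mk l :=
        ⟨y.right, y.hom, rfl⟩
      have h₁ := congrArg (fun w : Under ((hφ.mapGrpd n).obj s) =>
        Under.mk w.hom.hom.iso.hom) hy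
      obtain ⟨e, he⟩ := (Under.mk_eq_mk_iff _ _).1 (hopf.eq_of_map_eq l.hom.iso.hom g h₁)
      obtain rfl : y = s' := e
      obtain rfl : l = k := by
        ext
        exact (by simpa using he : l.hom.iso.hom = g)
      rfl
  exact key _ _ f.hom.hom.iso rfl f.right.property

/-- Maps from `φ s` to objects of degree `n` lift to maps from `s`; isomorphisms under `φ s` lift by
`exists_lift` and reflection of isomorphisms. -/
theorem isEquivalence_inclSquare (hopf : IsDiscreteOpfibration φ) (s : S) :
    ((hφ.inclSquare n).structuredArrowDownwards s).IsEquivalence where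
  faithful := ⟨by
    intro a b f g h
    have := hopf.faithful
    ext
    exact φ.map_injective (congrArg (fun t => t.right.hom.iso.hom) h)⟩
  full := ⟨by
    intro a b f
    have := hopf.reflectsIsomorphisms
    have := hopf.faithful
    have hf : (φ.map a.hom ≫ 𝟙 _) ≫ f.right.hom.iso.hom = φ.map b.hom ≫ 𝟙 _ :=
      StructuredArrow.w f
    obtain ⟨g, hg, hu⟩ := hopf.exists_lift a.hom b.hom f.right.hom.iso.hom
      ((congrArg (· ≫ f.right.hom.iso.hom) (Category.comp_id _).symm).trans
        (hf.trans (Category.comp_id _)))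
    have hf' : IsIso f.right.hom.iso.hom := inferInstance
    have : IsIso (φ.map g) := by rw [hg]; exact hf'
    have hg' : IsIso g := isIso_of_reflects_iso g φ
    refine ⟨StructuredArrow.homMk (ObjectProperty.homMk ⟨@asIso _ _ _ _ g hg'⟩) hu, ?_⟩
    ext
    exact hg⟩
  essSurj := ⟨by
    intro a
    have key : ∀ (r : R) (m : φ.obj s ⟶ r) (hr : B.deg r = n),
        ((hφ.inclSquare n).structuredArrowDownwards s).essImage
          (StructuredArrow.mk (Y := (⟨⟨r⟩, hr⟩ : B.Grpd n)) m) := by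
      intro r m
      induction m using hopf.induction_on with
      | H s' g =>
        intro hr
        exact ⟨StructuredArrow.mk (Y := (⟨⟨s'⟩, (hφ.map_deg s').symm.trans hr⟩ : A.Grpd n)) g,
          ⟨StructuredArrow.isoMk (Iso.refl _)
            ((Category.comp_id _).trans (Category.comp_id _))⟩⟩
    exact key _ a.hom a.right.property⟩

/-- The two maps of an object `φ s ⟶ r ⟶ r'` are lifted in succession. `reflects_pos` keeps the
lifts of positive maps positive. -/
theorem isEquivalence_posSquare (hopf : IsDiscreteOpfibration φ) (s : S) :
    ((hφ.posSquare n).structuredArrowDownwards s).IsEquivalence where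
  faithful := ⟨by
    intro a b f g h
    have := hopf.faithful
    ext
    · exact φ.map_injective (congrArg (fun t => t.right.hom.left.hom) h)
    · exact φ.map_injective (congrArg (fun t => t.right.hom.right.hom) h)⟩
  full := ⟨by
    intro a b f
    have hf : (φ.map a.hom ≫ 𝟙 _) ≫ f.right.hom.left.hom = φ.map b.hom ≫ 𝟙 _ :=
      StructuredArrow.w f
    have hw : f.right.hom.left.hom ≫ φ.map b.right.obj.hom.hom =
        φ.map a.right.obj.hom.hom ≫ f.right.hom.right.hom :=
      congrArg InducedWideCategory.Hom.hom f.right.hom.w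
    obtain ⟨g, k, hg, hk, hu, hgk⟩ := hopf.exists_square_lift a.hom b.hom
      a.right.obj.hom.hom b.right.obj.hom.hom f.right.hom.left.hom f.right.hom.right.hom
      ((congrArg (· ≫ f.right.hom.left.hom) (Category.comp_id _).symm).trans
        (hf.trans (Category.comp_id _))) hw
    have hg' : A.pos g := hφ.reflects_pos g (by rw [hg]; exact f.right.hom.left.property)
    have hk' : A.pos k := hφ.reflects_pos k (by rw [hk]; exact f.right.hom.right.property)
    refine ⟨StructuredArrow.homMk (ObjectProperty.homMk
      (Arrow.homMk ⟨g, hg'⟩ ⟨k, hk'⟩ (by ext; exact hgk))) hu, ?_⟩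
    ext
    · exact hg
    · exact hk⟩
  essSurj := ⟨by
    intro a
    have key : ∀ (r : R) (m : φ.obj s ⟶ r) (r' : R) (k : r ⟶ r') (hk : B.pos k)
        (hk' : ¬ IsIso k) (hr : B.deg r' = n),
        ((hφ.posSquare n).structuredArrowDownwards s).essImage
          (StructuredArrow.mk (Y := (⟨Arrow.mk (X := ⟨r⟩) (Y := ⟨r'⟩) ⟨k, hk⟩, hk', hr⟩ :
            B.PosArrow n)) m) := by
      intro r m
      induction m using hopf.induction_on with
      | H s' g =>
        intro r' k
        induction k using hopf.induction_on with
        | H s'' g' =>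
          intro hk hk' hr
          exact ⟨StructuredArrow.mk (Y := (⟨Arrow.mk (X := ⟨s'⟩) (Y := ⟨s''⟩)
            ⟨g', hφ.reflects_pos g' hk⟩, fun h => hk' (@Functor.map_isIso _ _ _ _ _ _ φ g' h),
              (hφ.map_deg s'').symm.trans hr⟩ : A.PosArrow n)) g,
            ⟨StructuredArrow.isoMk (Iso.refl _)
              ((Category.comp_id _).trans (Category.comp_id _))⟩⟩
    exact key _ a.hom _ a.right.obj.hom.hom a.right.obj.hom.property a.right.property.1
      a.right.property.2⟩

/-- The same argument for an isomorphism out of `φ s` followed by a negative map. It identifies the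
index categories of the matching objects at `s` and at `φ s`. -/
theorem isEquivalence_negSquare (hopf : IsDiscreteOpfibration φ) (s : A.Grpd n) :
    ((hφ.negSquare n).structuredArrowDownwards s).IsEquivalence where
  faithful := ⟨by
    intro a b f g h
    have := hopf.faithful
    ext
    · exact φ.map_injective (congrArg (fun t => t.right.hom.left.hom) h)
    · exact φ.map_injective (congrArg (fun t => t.right.hom.right.hom) h)⟩
  full := ⟨by
    intro a b f
    have := hopf.faithful
    have hf : (φ.map a.hom.hom.iso.hom ≫ 𝟙 _) ≫ f.right.hom.left.hom =
        φ.map b.hom.hom.iso.hom ≫ 𝟙 _ :=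
      congrArg (fun t => t.hom.iso.hom) (StructuredArrow.w f)
    have hw : f.right.hom.left.hom ≫ φ.map b.right.obj.hom.hom =
        φ.map a.right.obj.hom.hom ≫ f.right.hom.right.hom :=
      congrArg InducedWideCategory.Hom.hom f.right.hom.w
    obtain ⟨g, k, hg, hk, hu, hgk⟩ := hopf.exists_square_lift a.hom.hom.iso.hom b.hom.hom.iso.hom
      a.right.obj.hom.hom b.right.obj.hom.hom f.right.hom.left.hom f.right.hom.right.hom
      ((congrArg (· ≫ f.right.hom.left.hom) (Category.comp_id _).symm).trans
        (hf.trans (Category.comp_id _))) hw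
    have hg' : A.neg g := hφ.reflects_neg g (by rw [hg]; exact f.right.hom.left.property)
    have hk' : A.neg k := hφ.reflects_neg k (by rw [hk]; exact f.right.hom.right.property)
    refine ⟨StructuredArrow.homMk (ObjectProperty.homMk
      (Arrow.homMk ⟨g, hg'⟩ ⟨k, hk'⟩ (by ext; exact hgk))) (by ext; exact hu), ?_⟩
    ext
    · exact hg
    · exact hk⟩
  essSurj := ⟨by
    intro a
    have := hopf.reflectsIsomorphisms
    have key : ∀ (r : R) (m : φ.obj s.obj.of ⟶ r) (m' : φ.obj s.obj.of ≅ r) (_ : m'.hom = m)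
        (r' : R) (k : r ⟶ r') (hk : B.neg k) (hk' : ¬ IsIso k) (hr : B.deg r = n),
        ((hφ.negSquare n).structuredArrowDownwards s).essImage
          (StructuredArrow.mk (Y := (⟨Arrow.mk (X := ⟨r⟩) (Y := ⟨r'⟩) ⟨k, hk⟩, hk', hr⟩ :
            B.NegArrow n)) (ObjectProperty.homMk ⟨m'⟩)) := by
      intro r m
      induction m using hopf.induction_on with
      | H s' g =>
        intro m' hm' r' k
        have : IsIso (φ.map g) := by rw [← hm']; infer_instance
        have hg : IsIso g := isIso_of_reflects_iso g φ
        obtain rfl : m' = φ.mapIso (asIso g) := by ext; exact hm'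
        induction k using hopf.induction_on with
        | H s'' g' =>
          intro hk hk' hr
          exact ⟨StructuredArrow.mk (Y := (⟨Arrow.mk (X := ⟨s'⟩) (Y := ⟨s''⟩)
            ⟨g', hφ.reflects_neg g' hk⟩, fun h => hk' (@Functor.map_isIso _ _ _ _ _ _ φ g' h),
              (hφ.map_deg s').symm.trans hr⟩ : A.NegArrow n))
              (ObjectProperty.homMk ⟨@asIso _ _ _ _ g hg⟩),
            ⟨StructuredArrow.isoMk (Iso.refl _)
              (by ext; exact (Category.comp_id _).trans (Category.comp_id _))⟩⟩
    exact key _ a.hom.hom.iso.hom a.hom.hom.iso rfl _ a.right.obj.hom.hom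
      a.right.obj.hom.property a.right.property.1 a.right.property.2⟩

theorem guitartExact_inclSquare (hopf : IsDiscreteOpfibration φ) :
    (hφ.inclSquare n).GuitartExact := by
  rw [TwoSquare.guitartExact_iff_initial]
  intro s
  have := hφ.isEquivalence_inclSquare (n := n) hopf s
  infer_instance

theorem guitartExact_posSquare (hopf : IsDiscreteOpfibration φ) :
    (hφ.posSquare n).GuitartExact := by
  rw [TwoSquare.guitartExact_iff_initial]
  intro s
  have := hφ.isEquivalence_posSquare (n := n) hopf s
  infer_instance

end IsReedyFunctor

/-! ### Lifting against relative latching maps -/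

namespace GeneralizedReedy

variable {R : Type u} [SmallCategory R] (A : GeneralizedReedy R) (n : ℕ)
  {X Y : R ⥤ SSet.{u}} (f : X ⟶ Y) {E F : A.Grpd n ⥤ SSet.{u}} (p : E ⟶ F)

theorem inl_relLatchingMap :
    pushout.inl (A.latchingMap n X) ((A.latching n).map f) ≫ A.relLatchingMap n f =
      (A.restr n).map f :=
  pushout.inl_desc _ _ _

theorem inr_relLatchingMap :
    pushout.inr (A.latchingMap n X) ((A.latching n).map f) ≫ A.relLatchingMap n f =
      A.latchingMap n Y :=
  pushout.inr_desc _ _ _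

theorem inl_relLatchingMap_assoc (t : (A.restr n).obj Y ⟶ E) :
    pushout.inl (A.latchingMap n X) ((A.latching n).map f) ≫ A.relLatchingMap n f ≫ t =
      (A.restr n).map f ≫ t :=
  (Category.assoc _ _ _).symm.trans (congrArg (· ≫ t) (A.inl_relLatchingMap n f))

theorem inr_relLatchingMap_assoc (t : (A.restr n).obj Y ⟶ E) :
    pushout.inr (A.latchingMap n X) ((A.latching n).map f) ≫ A.relLatchingMap n f ≫ t =
      A.latchingMap n Y ≫ t :=
  (Category.assoc _ _ _).symm.trans (congrArg (· ≫ t) (A.inr_relLatchingMap n f))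

/-- The lifting property of a relative latching map, with the latching objects eliminated
by adjunction. -/
def LatchingLift : Prop :=
  ∀ (a : A.incl n ⋙ X ⟶ E) (b : A.incl n ⋙ Y ⟶ F) (c : A.posDom n ⋙ Y ⟶ A.posCod n ⋙ E),
    (∀ x : A.Grpd n, f.app x.obj.of ≫ b.app x = a.app x ≫ p.app x) →
    (∀ y : A.PosArrow n, f.app y.obj.left.obj ≫ c.app y =
      X.map y.obj.hom.hom ≫ a.app ((A.posCod n).obj y)) →
    (∀ y : A.PosArrow n, c.app y ≫ p.app ((A.posCod n).obj y) =
      Y.map y.obj.hom.hom ≫ b.app ((A.posCod n).obj y)) →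
    ∃ l : A.incl n ⋙ Y ⟶ E, (∀ x : A.Grpd n, f.app x.obj.of ≫ l.app x = a.app x) ∧
      (∀ x : A.Grpd n, l.app x ≫ p.app x = b.app x) ∧
      (∀ y : A.PosArrow n, Y.map y.obj.hom.hom ≫ l.app ((A.posCod n).obj y) = c.app y)

/-- A map out of the pushout is a pair of maps out of `Xₙ` and `Lₙ Y`, and the second transposes to
a map `dom^* Y ⟶ cod^* E`. Only restrictions remain, which exact squares can handle. -/
theorem hasLiftingProperty_relLatchingMap_iff :
    HasLiftingProperty (A.relLatchingMap n f) p ↔ A.LatchingLift n f p := by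
  let adj := (A.posCod n).lanAdjunction SSet.{u}
  have hl {X Y : R ⥤ SSet.{u}} (f : X ⟶ Y) {E : A.Grpd n ⥤ SSet.{u}}
      (c : A.posDom n ⋙ Y ⟶ A.posCod n ⋙ E) :
      (adj.homEquiv (A.posDom n ⋙ X) E).symm (Functor.whiskerLeft (A.posDom n) f ≫ c) =
        (A.latching n).map f ≫ (adj.homEquiv (A.posDom n ⋙ Y) E).symm c :=
    adj.homEquiv_naturality_left_symm _ _
  have hr {X : R ⥤ SSet.{u}} {E : A.Grpd n ⥤ SSet.{u}} (a : A.incl n ⋙ X ⟶ E) :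
      (adj.homEquiv (A.posDom n ⋙ X) E).symm (Functor.whiskerRight (A.posArrowHom n) X ≫
        Functor.whiskerLeft (A.posCod n) a) = A.latchingMap n X ≫ a :=
    adj.homEquiv_naturality_right_symm (Y := A.incl n ⋙ X)
      (Functor.whiskerRight (A.posArrowHom n) X) a
  have hr' {X : R ⥤ SSet.{u}} {E F : A.Grpd n ⥤ SSet.{u}} (p : E ⟶ F)
      (c : A.posDom n ⋙ X ⟶ A.posCod n ⋙ E) :
      (adj.homEquiv (A.posDom n ⋙ X) F).symm (c ≫ Functor.whiskerLeft (A.posCod n) p) =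
        (adj.homEquiv (A.posDom n ⋙ X) E).symm c ≫ p :=
    adj.homEquiv_naturality_right_symm _ _
  constructor
  · intro H a b c h₁ h₂ h₃
    have h₁' : (A.restr n).map f ≫ b = a ≫ p := by ext1; ext1 x; exact h₁ x
    have h₂' : A.latchingMap n X ≫ a =
        (A.latching n).map f ≫ (adj.homEquiv (A.posDom n ⋙ Y) E).symm c := by
      rw [← hl, ← hr]
      congr 1
      ext1; ext1 y
      exact (h₂ y).symm
    have h₃' : (adj.homEquiv (A.posDom n ⋙ Y) E).symm c ≫ p = A.latchingMap n Y ≫ b := by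
      rw [← hr', ← hr]
      congr 1
      ext1; ext1 y
      exact h₃ y
    have sq : CommSq (pushout.desc a _ h₂') (A.relLatchingMap n f) p b := ⟨by
      apply pushout.hom_ext
      · rw [pushout.inl_desc_assoc, inl_relLatchingMap_assoc, h₁']
      · rw [pushout.inr_desc_assoc, inr_relLatchingMap_assoc, h₃']⟩
    have e₁ : (A.restr n).map f ≫ sq.lift = a := by
      rw [← inl_relLatchingMap_assoc, sq.fac_left, pushout.inl_desc]
    have e₂ : A.latchingMap n Y ≫ sq.lift = (adj.homEquiv (A.posDom n ⋙ Y) E).symm c := by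
      rw [← inr_relLatchingMap_assoc, sq.fac_left, pushout.inr_desc]
    rw [← hr] at e₂
    have e₂ := (adj.homEquiv _ _).symm.injective e₂
    exact ⟨sq.lift, fun x => NatTrans.congr_app e₁ x, fun x => NatTrans.congr_app sq.fac_right x,
      fun y => NatTrans.congr_app e₂ y⟩
  · intro H
    refine ⟨fun {t b} sq => ?_⟩
    let a := pushout.inl _ _ ≫ t
    let c := adj.homEquiv (A.posDom n ⋙ Y) E (pushout.inr _ _ ≫ t)
    have hc : (adj.homEquiv (A.posDom n ⋙ Y) E).symm c = pushout.inr _ _ ≫ t :=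
      Equiv.symm_apply_apply _ _
    have h₁ : (A.restr n).map f ≫ b = a ≫ p := by
      rw [← inl_relLatchingMap_assoc, ← sq.w, Category.assoc]
    have h₂ : Functor.whiskerLeft (A.posDom n) f ≫ c =
        Functor.whiskerRight (A.posArrowHom n) X ≫ Functor.whiskerLeft (A.posCod n) a := by
      apply (adj.homEquiv _ _).symm.injective
      rw [hl, hr, hc]
      exact (pushout.condition_assoc _).symm
    have h₃ : c ≫ Functor.whiskerLeft (A.posCod n) p =
        Functor.whiskerRight (A.posArrowHom n) Y ≫ Functor.whiskerLeft (A.posCod n) b := by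
      apply (adj.homEquiv _ _).symm.injective
      rw [hr', hr, hc]
      rw [← inr_relLatchingMap_assoc, ← sq.w, Category.assoc]
    obtain ⟨l, e₁, e₂, e₃⟩ := H a b c (fun x => NatTrans.congr_app h₁ x)
      (fun y => NatTrans.congr_app h₂ y) (fun y => NatTrans.congr_app h₃ y)
    refine ⟨⟨⟨l, ?_, by ext1; ext1 x; exact e₂ x⟩⟩⟩
    apply pushout.hom_ext
    · rw [inl_relLatchingMap_assoc]
      ext1; ext1 x
      exact e₁ x
    · rw [inr_relLatchingMap_assoc, ← hc, ← hr]
      congr 1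
      ext1; ext1 y
      exact e₃ y

end GeneralizedReedy

/-! ### Guitart exact squares and left Kan extensions -/

namespace CategoryTheory.TwoSquare

variable {C₁ C₂ C₃ C₄ : Type u} [SmallCategory C₁] [SmallCategory C₂] [SmallCategory C₃]
  [SmallCategory C₄] {T : C₁ ⥤ C₂} {L : C₁ ⥤ C₃} {Φ : C₂ ⥤ C₄} {B : C₃ ⥤ C₄}
  (w : TwoSquare T L Φ B) [w.GuitartExact] {X : C₂ ⥤ SSet.{u}} {E : C₃ ⥤ SSet.{u}}

/-- The restriction of the unit of left Kan extension along a 2-square. -/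
noncomputable def lanUnitApp {T : C₁ ⥤ C₂} {L : C₁ ⥤ C₃} {Φ : C₂ ⥤ C₄} {B : C₃ ⥤ C₄}
    (w : TwoSquare T L Φ B) (X : C₂ ⥤ SSet.{u}) : T ⋙ X ⟶ L ⋙ B ⋙ Φ.lan.obj X where
  app x := (Φ.lanUnit.app X).app (T.obj x) ≫ (Φ.lan.obj X).map (w.app x)
  naturality x y f := by
    have h₁ := (Φ.lanUnit.app X).naturality (T.map f)
    have h₂ := congrArg (Φ.lan.obj X).map (w.naturality f)
    dsimp at h₁ h₂ ⊢
    rw [Functor.map_comp, Functor.map_comp] at h₂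
    rw [reassoc_of% h₁, h₂, Category.assoc]

/-- Beck–Chevalley: a pointwise left Kan extension stays one when pasted with a Guitart exact
square. -/
theorem isLeftKanExtension_lanUnitApp (X : C₂ ⥤ SSet.{u}) :
    (B ⋙ Φ.lan.obj X).IsLeftKanExtension (w.lanUnitApp X) := by
  have h := (Functor.LeftExtension.IsPointwiseLeftKanExtension.compTwoSquare
    (Φ.isPointwiseLeftKanExtensionLeftKanExtensionUnit X) w).isLeftKanExtension
  have e : w.lanUnitApp X =
      ((Functor.LeftExtension.mk _ (Φ.lanUnit.app X)).compTwoSquare w).hom := by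
    ext1; ext1 x
    exact congrArg ((Φ.lanUnit.app X).app (T.obj x) ≫ ·)
      ((congrArg (𝟙 _ ≫ ·) (Category.comp_id _)).trans (Category.id_comp _)).symm
  rw [e]
  exact h

theorem lan_hom_ext {γ₁ γ₂ : B ⋙ Φ.lan.obj X ⟶ E}
    (h : ∀ x : C₁, (w.lanUnitApp X).app x ≫ γ₁.app (L.obj x) =
      (w.lanUnitApp X).app x ≫ γ₂.app (L.obj x)) : γ₁ = γ₂ := by
  have := w.isLeftKanExtension_lanUnitApp X
  apply Functor.hom_ext_of_isLeftKanExtension _ (w.lanUnitApp X)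
  ext1; ext1 x
  exact h x

theorem exists_lan_hom (β : T ⋙ X ⟶ L ⋙ E) : ∃ γ : B ⋙ Φ.lan.obj X ⟶ E, ∀ x : C₁,
    (w.lanUnitApp X).app x ≫ γ.app (L.obj x) = β.app x := by
  have := w.isLeftKanExtension_lanUnitApp X
  exact ⟨Functor.descOfIsLeftKanExtension _ (w.lanUnitApp X) E β, fun x =>
    Functor.descOfIsLeftKanExtension_fac_app _ (w.lanUnitApp X) E β x⟩

end CategoryTheory.TwoSquare

/-! ### Cofibrations and left Kan extension -/

namespace CategoryTheory.Functor

variable {S R : Type u} [SmallCategory S] [SmallCategory R] (φ : S ⥤ R)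

/-- The components of the unit of left Kan extension. -/
noncomputable def lanι (X : S ⥤ SSet.{u}) (s : S) : X.obj s ⟶ (φ.lan.obj X).obj (φ.obj s) :=
  (φ.lanUnit.app X).app s

theorem lanι_comp_lan_map {X Y : S ⥤ SSet.{u}} (g : X ⟶ Y) (s : S) :
    φ.lanι X s ≫ (φ.lan.map g).app (φ.obj s) = g.app s ≫ φ.lanι Y s :=
  (NatTrans.congr_app (φ.lanUnit.naturality g) s).symm

theorem lanι_comp_lan_map_assoc {X Y : S ⥤ SSet.{u}} (g : X ⟶ Y) (s : S) {Z : SSet.{u}}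
    (h : (φ.lan.obj Y).obj (φ.obj s) ⟶ Z) :
    φ.lanι X s ≫ (φ.lan.map g).app (φ.obj s) ≫ h = g.app s ≫ φ.lanι Y s ≫ h := by
  rw [reassoc_of% φ.lanι_comp_lan_map g s]

theorem lanι_comp_map (X : S ⥤ SSet.{u}) {s t : S} (k : s ⟶ t) :
    φ.lanι X s ≫ (φ.lan.obj X).map (φ.map k) = X.map k ≫ φ.lanι X t :=
  ((φ.lanUnit.app X).naturality k).symm

theorem lanι_comp_map_assoc (X : S ⥤ SSet.{u}) {s t : S} (k : s ⟶ t) {Z : SSet.{u}}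
    (h : (φ.lan.obj X).obj (φ.obj t) ⟶ Z) :
    φ.lanι X s ≫ (φ.lan.obj X).map (φ.map k) ≫ h = X.map k ≫ φ.lanι X t ≫ h := by
  rw [reassoc_of% φ.lanι_comp_map X k]

end CategoryTheory.Functor

namespace IsReedyFunctor

variable {S R : Type u} [SmallCategory S] [SmallCategory R] {A : GeneralizedReedy S}
  {B : GeneralizedReedy R} {φ : S ⥤ R} (hφ : IsReedyFunctor A B φ)
  (hopf : IsDiscreteOpfibration φ) {n : ℕ} {X Y : S ⥤ SSet.{u}}

theorem inclSquare_lanUnitApp_app (x : A.Grpd n) :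
    ((hφ.inclSquare n).lanUnitApp X).app x = φ.lanι X x.obj.of :=
  (congrArg (φ.lanι X x.obj.of ≫ ·) ((φ.lan.obj X).map_id _)).trans (Category.comp_id _)

theorem posSquare_lanUnitApp_app (y : A.PosArrow n) :
    ((hφ.posSquare n).lanUnitApp X).app y = φ.lanι X y.obj.left.obj :=
  (congrArg (φ.lanι X y.obj.left.obj ≫ ·) ((φ.lan.obj X).map_id _)).trans (Category.comp_id _)

section

variable {E : B.Grpd n ⥤ SSet.{u}}

include hopf

theorem incl_hom_ext {γ₁ γ₂ : B.incl n ⋙ φ.lan.obj X ⟶ E}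
    (h : ∀ x : A.Grpd n, φ.lanι X x.obj.of ≫ γ₁.app ((hφ.mapGrpd n).obj x) =
      φ.lanι X x.obj.of ≫ γ₂.app ((hφ.mapGrpd n).obj x)) : γ₁ = γ₂ := by
  have := hφ.guitartExact_inclSquare (n := n) hopf
  refine (hφ.inclSquare n).lan_hom_ext fun x => ?_
  rw [inclSquare_lanUnitApp_app]
  exact h x

theorem exists_incl_hom (β : A.incl n ⋙ X ⟶ hφ.mapGrpd n ⋙ E) :
    ∃ γ : B.incl n ⋙ φ.lan.obj X ⟶ E, ∀ x : A.Grpd n,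
      φ.lanι X x.obj.of ≫ γ.app ((hφ.mapGrpd n).obj x) = β.app x := by
  have := hφ.guitartExact_inclSquare (n := n) hopf
  obtain ⟨γ, hγ⟩ := (hφ.inclSquare n).exists_lan_hom β
  refine ⟨γ, fun x => ?_⟩
  rw [← hγ, inclSquare_lanUnitApp_app]
  rfl

theorem pos_hom_ext {γ₁ γ₂ : B.posDom n ⋙ φ.lan.obj X ⟶ B.posCod n ⋙ E}
    (h : ∀ y : A.PosArrow n, φ.lanι X y.obj.left.obj ≫ γ₁.app ((hφ.mapPos n).obj y) =
      φ.lanι X y.obj.left.obj ≫ γ₂.app ((hφ.mapPos n).obj y)) : γ₁ = γ₂ := by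
  have := hφ.guitartExact_posSquare (n := n) hopf
  refine (hφ.posSquare n).lan_hom_ext fun x => ?_
  rw [posSquare_lanUnitApp_app]
  exact h x

theorem exists_pos_hom (β : A.posDom n ⋙ X ⟶ A.posCod n ⋙ hφ.mapGrpd n ⋙ E) :
    ∃ γ : B.posDom n ⋙ φ.lan.obj X ⟶ B.posCod n ⋙ E, ∀ y : A.PosArrow n,
      φ.lanι X y.obj.left.obj ≫ γ.app ((hφ.mapPos n).obj y) = β.app y := by
  have := hφ.guitartExact_posSquare (n := n) hopf
  obtain ⟨γ, hγ⟩ := (hφ.posSquare n).exists_lan_hom (E := B.posCod n ⋙ E)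
    (β ≫ Functor.whiskerRight (hφ.mapPosCompPosCod n).inv E)
  refine ⟨γ, fun y => ?_⟩
  have h := hγ y
  rw [posSquare_lanUnitApp_app] at h
  exact h.trans ((congrArg (β.app y ≫ ·) (E.map_id _)).trans (Category.comp_id _))

omit hopf

theorem exists_incl_restrict (γ : B.incl n ⋙ φ.lan.obj X ⟶ E) :
    ∃ β : A.incl n ⋙ X ⟶ hφ.mapGrpd n ⋙ E, ∀ x : A.Grpd n,
      β.app x = φ.lanι X x.obj.of ≫ γ.app ((hφ.mapGrpd n).obj x) := by
  refine ⟨(hφ.inclSquare n).lanUnitApp X ≫ Functor.whiskerLeft (hφ.mapGrpd n) γ, fun x => ?_⟩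
  rw [← inclSquare_lanUnitApp_app]
  rfl

theorem exists_pos_restrict (γ : B.posDom n ⋙ φ.lan.obj X ⟶ B.posCod n ⋙ E) :
    ∃ β : A.posDom n ⋙ X ⟶ A.posCod n ⋙ hφ.mapGrpd n ⋙ E, ∀ y : A.PosArrow n,
      β.app y = φ.lanι X y.obj.left.obj ≫ γ.app ((hφ.mapPos n).obj y) := by
  refine ⟨((hφ.posSquare n).lanUnitApp X ≫ Functor.whiskerLeft (hφ.mapPos n) γ) ≫
    Functor.whiskerRight (hφ.mapPosCompPosCod n).hom E, fun y => ?_⟩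
  rw [← hφ.posSquare_lanUnitApp_app]
  exact (congrArg (_ ≫ ·) (E.map_id _)).trans (Category.comp_id _)

end

include hφ hopf

/-- Lifting properties of relative latching maps are transferred along the adjunction between
left Kan extension and restriction. -/
theorem latchingLift_lan_iff (g : X ⟶ Y) {E F : B.Grpd n ⥤ SSet.{u}} (p : E ⟶ F) :
    B.LatchingLift n (φ.lan.map g) p ↔
      A.LatchingLift n g (Functor.whiskerLeft (hφ.mapGrpd n) p) := by
  constructor
  · intro H a b c h₁ h₂ h₃
    -- The data extend uniquely along the units, so the equations for the extended problem need
    -- checking only after composition with the units.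
    obtain ⟨a', ha⟩ := hφ.exists_incl_hom hopf a
    obtain ⟨b', hb⟩ := hφ.exists_incl_hom hopf b
    obtain ⟨c', hc⟩ := hφ.exists_pos_hom hopf c
    obtain ⟨l, e₁, e₂, e₃⟩ := H a' b' c'
      (NatTrans.congr_app (hφ.incl_hom_ext hopf (γ₁ := Functor.whiskerLeft _ (φ.lan.map g) ≫ b')
        (γ₂ := a' ≫ p) fun x => by
          refine (φ.lanι_comp_lan_map_assoc g _ _).trans ?_
          rw [hb]
          refine (h₁ x).trans ?_
          rw [← ha]
          exact Category.assoc _ _ _))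
      (NatTrans.congr_app (hφ.pos_hom_ext hopf (γ₁ := Functor.whiskerLeft _ (φ.lan.map g) ≫ c')
        (γ₂ := Functor.whiskerRight (B.posArrowHom n) _ ≫ Functor.whiskerLeft _ a') fun y => by
          refine (φ.lanι_comp_lan_map_assoc g _ _).trans ?_
          rw [hc]
          refine (h₂ y).trans ?_
          rw [← ha]
          exact (φ.lanι_comp_map_assoc X _ _).symm))
      (NatTrans.congr_app (hφ.pos_hom_ext hopf (γ₁ := c' ≫ Functor.whiskerLeft _ p)
        (γ₂ := Functor.whiskerRight (B.posArrowHom n) _ ≫ Functor.whiskerLeft _ b') fun y => by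
          refine (Category.assoc _ _ _).symm.trans ?_
          rw [hc]
          refine (h₃ y).trans ?_
          rw [← hb]
          exact (φ.lanι_comp_map_assoc Y _ _).symm))
    obtain ⟨l', hl⟩ := hφ.exists_incl_restrict l
    refine ⟨l', fun x => ?_, fun x => ?_, fun y => ?_⟩
    · rw [hl, ← ha, ← e₁]
      exact (φ.lanι_comp_lan_map_assoc g _ _).symm
    · rw [hl, ← hb, ← e₂]
      exact Category.assoc _ _ _
    · rw [hl, ← hc, ← e₃]
      exact (φ.lanι_comp_map_assoc Y _ _).symm
  · intro H a b c h₁ h₂ h₃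
    -- In the other direction the data are restricted along the units, the problem is solved over
    -- `S`, and the solution is extended.
    obtain ⟨a', ha⟩ := hφ.exists_incl_restrict a
    obtain ⟨b', hb⟩ := hφ.exists_incl_restrict b
    obtain ⟨c', hc⟩ := hφ.exists_pos_restrict c
    obtain ⟨l, e₁, e₂, e₃⟩ := H a' b' c'
      (fun x => by
        rw [ha, hb]
        refine (φ.lanι_comp_lan_map_assoc g _ _).symm.trans ?_
        exact (congrArg (φ.lanι X _ ≫ ·) (h₁ _)).trans (Category.assoc _ _ _).symm)
      (fun y => by
        rw [ha, hc]
        refine (φ.lanι_comp_lan_map_assoc g _ _).symm.trans ?_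
        exact (congrArg (φ.lanι X _ ≫ ·) (h₂ _)).trans (φ.lanι_comp_map_assoc X _ _))
      (fun y => by
        rw [hb, hc]
        refine (Category.assoc _ _ _).trans ?_
        exact (congrArg (φ.lanι Y _ ≫ ·) (h₃ _)).trans (φ.lanι_comp_map_assoc Y _ _))
    obtain ⟨l', hl⟩ := hφ.exists_incl_hom hopf l
    refine ⟨l',
      NatTrans.congr_app (hφ.incl_hom_ext hopf (γ₁ := Functor.whiskerLeft _ (φ.lan.map g) ≫ l')
        (γ₂ := a) fun x => ?_),
      NatTrans.congr_app (hφ.incl_hom_ext hopf (γ₁ := l' ≫ p) (γ₂ := b) fun x => ?_),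
      NatTrans.congr_app (hφ.pos_hom_ext hopf
        (γ₁ := Functor.whiskerRight (B.posArrowHom n) _ ≫ Functor.whiskerLeft _ l')
        (γ₂ := c) fun y => ?_)⟩
    · refine (φ.lanι_comp_lan_map_assoc g _ _).trans ?_
      rw [hl, ← ha]
      exact e₁ x
    · refine (Category.assoc _ _ _).symm.trans ?_
      rw [hl, ← hb]
      exact e₂ x
    · refine (φ.lanι_comp_map_assoc Y _ _).trans ?_
      rw [← hc, ← e₃]
      exact congrArg (Y.map _ ≫ ·) (hl ((A.posCod n).obj y))

theorem reedyCofibrations_lan_iff (g : X ⟶ Y) :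
    B.reedyCofibrations (φ.lan.map g) ↔ A.reedyCofibrations g := by
  constructor
  · intro H n E F p hp
    have hopf' := hφ.isDiscreteOpfibration_mapGrpd (n := n) hopf
    -- The hypothesis speaks only of diagrams on `B.Grpd n`, so `p` is first pushed forward there.
    have h := H n ((hφ.mapGrpd n).lan.map p) ⟨hopf'.fibrations_lan_map p hp.1,
      (hopf'.weakEquivalences_lan_map_iff p).2 hp.2⟩
    rw [GeneralizedReedy.hasLiftingProperty_relLatchingMap_iff, hφ.latchingLift_lan_iff hopf,
      ← GeneralizedReedy.hasLiftingProperty_relLatchingMap_iff] at h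
    -- The cartesian unit exhibits `p` as a pullback of its pushed-forward and restricted version,
    -- so it inherits the lifting property.
    exact (IsPullback.of_forall_isPullback_app (f₁ := (hφ.mapGrpd n).lanUnit.app E)
      (f₃ := Functor.whiskerLeft (hφ.mapGrpd n) ((hφ.mapGrpd n).lan.map p))
      (f₄ := (hφ.mapGrpd n).lanUnit.app F)
      fun s => hopf'.isPullback_lanUnit_app p s).hasLiftingProperty _
  · intro H n E F p hp
    rw [GeneralizedReedy.hasLiftingProperty_relLatchingMap_iff, hφ.latchingLift_lan_iff hopf,
      ← GeneralizedReedy.hasLiftingProperty_relLatchingMap_iff]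
    exact H n _ ⟨fun s => hp.1 _, fun s => hp.2 _⟩

end IsReedyFunctor

/-! ### Lifting against relative matching maps -/

namespace GeneralizedReedy

variable {R : Type u} [SmallCategory R] (A : GeneralizedReedy R) {n : ℕ}

/-- The target of an object of the index category of the matching object at `x`. -/
noncomputable def negObj {x : A.Grpd n} (j : StructuredArrow x (A.negDom n)) : R :=
  j.right.obj.right.obj

/-- The map between targets induced by a map in the index category of the matching object. -/
noncomputable def negObjMap {x : A.Grpd n} {j k : StructuredArrow x (A.negDom n)} (m : j ⟶ k) :
    A.negObj j ⟶ A.negObj k :=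
  m.right.hom.right.hom

/-- The negative map underlying an object of the index category of the matching object at `x`. -/
noncomputable def negMap {x : A.Grpd n} (j : StructuredArrow x (A.negDom n)) :
    x.obj.of ⟶ A.negObj j :=
  j.hom.hom.iso.hom ≫ j.right.obj.hom.hom

theorem negMap_comp {x : A.Grpd n} {j k : StructuredArrow x (A.negDom n)} (m : j ⟶ k) :
    A.negMap j ≫ A.negObjMap m = A.negMap k := by
  have h₁ : j.hom.hom.iso.hom ≫ m.right.hom.left.hom = k.hom.hom.iso.hom :=
    congrArg (fun t => t.hom.iso.hom) (StructuredArrow.w m)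
  have h₂ : m.right.hom.left.hom ≫ k.right.obj.hom.hom =
      j.right.obj.hom.hom ≫ m.right.hom.right.hom :=
    congrArg InducedWideCategory.Hom.hom m.right.hom.w
  calc
    _ = j.hom.hom.iso.hom ≫ j.right.obj.hom.hom ≫ m.right.hom.right.hom := Category.assoc _ _ _
    _ = j.hom.hom.iso.hom ≫ m.right.hom.left.hom ≫ k.right.obj.hom.hom :=
      congrArg (j.hom.hom.iso.hom ≫ ·) h₂.symm
    _ = (j.hom.hom.iso.hom ≫ m.right.hom.left.hom) ≫ k.right.obj.hom.hom :=
      (Category.assoc _ _ _).symm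
    _ = _ := congrArg (· ≫ k.right.obj.hom.hom) h₁

/-- The projections from the matching object. -/
noncomputable def matchingπ (X : R ⥤ SSet.{u}) {x : A.Grpd n}
    (j : StructuredArrow x (A.negDom n)) :
    ((A.matching n).obj X).obj x ⟶ X.obj (A.negObj j) :=
  ((A.matching n).obj X).map j.hom ≫ ((A.negDom n).ranCounit.app (A.negCod n ⋙ X)).app j.right

theorem matching_map_π {X Y : R ⥤ SSet.{u}} (f : X ⟶ Y) {x : A.Grpd n}
    (j : StructuredArrow x (A.negDom n)) :
    ((A.matching n).map f).app x ≫ A.matchingπ Y j =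
      A.matchingπ X j ≫ f.app (A.negObj j) := by
  have h₁ := ((A.matching n).map f).naturality j.hom
  have h₂ := NatTrans.congr_app
    ((A.negDom n).ranCounit.naturality (Functor.whiskerLeft (A.negCod n) f)) j.right
  refine (Category.assoc _ _ _).symm.trans ((congrArg (· ≫ _) h₁.symm).trans ?_)
  refine (Category.assoc _ _ _).trans ((congrArg (_ ≫ ·) h₂).trans ?_)
  exact (Category.assoc _ _ _).symm

theorem matchingMap_π (X : R ⥤ SSet.{u}) {x : A.Grpd n} (j : StructuredArrow x (A.negDom n)) :
    (A.matchingMap n X).app x ≫ A.matchingπ X j = X.map (A.negMap j) := by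
  have h₁ := (A.matchingMap n X).naturality j.hom
  have h₂ : Functor.whiskerLeft (A.negDom n) (A.matchingMap n X) ≫
      (A.negDom n).ranCounit.app (A.negCod n ⋙ X) = Functor.whiskerRight (A.negArrowHom n) X := by
    have := ((A.negDom n).ranAdjunction SSet.{u}).homEquiv_counit (X := A.incl n ⋙ X)
      (Y := A.negCod n ⋙ X) (g := A.matchingMap n X)
    rw [matchingMap, Equiv.symm_apply_apply, Functor.ranAdjunction_counit] at this
    exact this.symm
  refine (Category.assoc _ _ _).symm.trans ((congrArg (· ≫ _) h₁.symm).trans ?_)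
  refine (Category.assoc _ _ _).trans
    ((congrArg (_ ≫ ·) (NatTrans.congr_app h₂ j.right)).trans ?_)
  exact (X.map_comp _ _).symm

theorem matchingπ_comp (X : R ⥤ SSet.{u}) {x : A.Grpd n} {j k : StructuredArrow x (A.negDom n)}
    (m : j ⟶ k) : A.matchingπ X j ≫ X.map (A.negObjMap m) = A.matchingπ X k :=
  ((Functor.RightExtension.mk _ ((A.negDom n).ranCounit.app (A.negCod n ⋙ X))).coneAt x).w m

/-- The matching object is a limit. -/
noncomputable def isLimitMatching (X : R ⥤ SSet.{u}) (x : A.Grpd n) :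
    IsLimit ((Functor.RightExtension.mk _
      ((A.negDom n).ranCounit.app (A.negCod n ⋙ X))).coneAt x) :=
  (A.negDom n).isPointwiseRightKanExtensionRanCounit (A.negCod n ⋙ X) x

theorem matching_hom_ext {X : R ⥤ SSet.{u}} {x : A.Grpd n} {V : SSet.{u}}
    {m m' : V ⟶ ((A.matching n).obj X).obj x}
    (h : ∀ j : StructuredArrow x (A.negDom n), m ≫ A.matchingπ X j = m' ≫ A.matchingπ X j) :
    m = m' :=
  (A.isLimitMatching X x).hom_ext h

theorem exists_hom_matching {X : R ⥤ SSet.{u}} {x : A.Grpd n} {V : SSet.{u}}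
    (c : ∀ j : StructuredArrow x (A.negDom n), V ⟶ X.obj (A.negObj j))
    (hc : ∀ ⦃j k : StructuredArrow x (A.negDom n)⦄ (m : j ⟶ k), c j ≫ X.map (A.negObjMap m) = c k) :
    ∃ m : V ⟶ ((A.matching n).obj X).obj x, ∀ j, m ≫ A.matchingπ X j = c j :=
  ⟨(A.isLimitMatching X x).lift
    { pt := V, π := { app := c, naturality _ _ m := (Category.id_comp _).trans (hc m).symm } },
    (A.isLimitMatching X x).fac _⟩

/-- The lifting property of a relative matching map at `x` for a given map to `Y x`, with the
matching objects expanded as limits. -/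
def MatchingLift {X Y : R ⥤ SSet.{u}} (f : X ⟶ Y) (x : A.Grpd n) {U V : SSet.{u}} (i : U ⟶ V)
    (b : V ⟶ Y.obj x.obj.of) : Prop :=
  ∀ (a : U ⟶ X.obj x.obj.of)
    (c : ∀ j : StructuredArrow x (A.negDom n), V ⟶ X.obj (A.negObj j)),
    (∀ ⦃j k : StructuredArrow x (A.negDom n)⦄ (m : j ⟶ k), c j ≫ X.map (A.negObjMap m) = c k) →
    i ≫ b = a ≫ f.app x.obj.of →
    (∀ j, i ≫ c j = a ≫ X.map (A.negMap j)) →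
    (∀ j, c j ≫ f.app _ = b ≫ Y.map (A.negMap j)) →
    ∃ l : V ⟶ X.obj x.obj.of, i ≫ l = a ∧ l ≫ f.app x.obj.of = b ∧
      ∀ j, l ≫ X.map (A.negMap j) = c j

/-- A map into the pullback is a map `b` to `Y x` with a compatible family `c` over it. Keeping `b`
as an outer variable allows a summand to be chosen from it. -/
theorem hasLiftingProperty_relMatchingMap_iff {X Y : R ⥤ SSet.{u}} (f : X ⟶ Y) (x : A.Grpd n)
    {U V : SSet.{u}} (i : U ⟶ V) :
    HasLiftingProperty i ((A.relMatchingMap n f).app x) ↔ ∀ b, A.MatchingLift f x i b := by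
  let M := pullback ((A.matching n).map f) (A.matchingMap n Y)
  let p : M.obj x ⟶ ((A.matching n).obj X).obj x := (pullback.fst _ (A.matchingMap n Y)).app x
  let q : M.obj x ⟶ Y.obj x.obj.of := (pullback.snd ((A.matching n).map f) _).app x
  let r : X.obj x.obj.of ⟶ M.obj x := (A.relMatchingMap n f).app x
  let mX : X.obj x.obj.of ⟶ ((A.matching n).obj X).obj x := (A.matchingMap n X).app x
  let mY : Y.obj x.obj.of ⟶ ((A.matching n).obj Y).obj x := (A.matchingMap n Y).app x
  let mf : ((A.matching n).obj X).obj x ⟶ ((A.matching n).obj Y).obj x :=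
    ((A.matching n).map f).app x
  have hM : IsPullback p q mf mY :=
    (IsPullback.of_hasPullback ((A.matching n).map f) (A.matchingMap n Y)).app x
  have hp : r ≫ p = mX := NatTrans.congr_app (pullback.lift_fst _ _ _) x
  have hq : r ≫ q = f.app x.obj.of := NatTrans.congr_app (pullback.lift_snd _ _ _) x
  have hX (j) : mX ≫ A.matchingπ X j = X.map (A.negMap j) := A.matchingMap_π X j
  have hY (j) : mY ≫ A.matchingπ Y j = Y.map (A.negMap j) := A.matchingMap_π Y j
  have hf (j : StructuredArrow x (A.negDom n)) :
      mf ≫ A.matchingπ Y j = A.matchingπ X j ≫ f.app _ := A.matching_map_π f j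
  change HasLiftingProperty i r ↔ _
  constructor
  · intro H b a c hc h₁ h₂ h₃
    obtain ⟨m, hm⟩ := A.exists_hom_matching c hc
    have hmb : m ≫ mf = b ≫ mY := A.matching_hom_ext fun j => by
      rw [Category.assoc, Category.assoc, hf, hY, ← h₃, ← hm, Category.assoc]
    have sq : CommSq a i r (hM.lift m b hmb) := ⟨hM.hom_ext
      (A.matching_hom_ext fun j => by
        rw [Category.assoc, Category.assoc, Category.assoc, Category.assoc, hM.lift_fst_assoc,
          reassoc_of% hp, hX, hm, h₂])
      (by rw [Category.assoc, Category.assoc, hM.lift_snd, hq, h₁])⟩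
    refine ⟨sq.lift, by simp, ?_, fun j => ?_⟩
    · rw [← hq, sq.fac_right_assoc, hM.lift_snd]
    · rw [← hX, ← hp, Category.assoc, sq.fac_right_assoc, hM.lift_fst_assoc, hm]
  · intro H
    refine ⟨fun {a v} sq => ?_⟩
    obtain ⟨l, e₁, e₂, e₃⟩ := H (v ≫ q) a (fun j => v ≫ p ≫ A.matchingπ X j)
      (fun j k m => by rw [Category.assoc, Category.assoc, matchingπ_comp])
      (by rw [← sq.w_assoc, hq])
      (fun j => by rw [← sq.w_assoc, reassoc_of% hp, hX])
      (fun j => by rw [Category.assoc, Category.assoc, Category.assoc, ← hf, hM.w_assoc, hY])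
    refine ⟨⟨⟨l, e₁, hM.hom_ext (A.matching_hom_ext fun j => ?_) ?_⟩⟩⟩
    · rw [Category.assoc, Category.assoc, Category.assoc, reassoc_of% hp, hX, e₃]
    · rw [Category.assoc, hq, e₂]

end GeneralizedReedy

/-! ### Fibrations and left Kan extension -/

namespace IsReedyFunctor

variable {S R : Type u} [SmallCategory S] [SmallCategory R] {A : GeneralizedReedy S}
  {B : GeneralizedReedy R} {φ : S ⥤ R} (hφ : IsReedyFunctor A B φ)
  {n : ℕ} {s : A.Grpd n}

/-- The functor induced by `φ` on index categories of matching objects. -/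
noncomputable def negDown (s : A.Grpd n) : StructuredArrow s (A.negDom n) ⥤
    StructuredArrow ((hφ.mapGrpd n).obj s) (B.negDom n) :=
  (hφ.negSquare n).structuredArrowDownwards s

theorem map_negMap_negDown (Z : R ⥤ SSet.{u}) (j : StructuredArrow s (A.negDom n)) :
    Z.map (B.negMap ((hφ.negDown s).obj j)) = Z.map (φ.map (A.negMap j)) := by
  have h : B.negMap ((hφ.negDown s).obj j) =
      (φ.map j.hom.hom.iso.hom ≫ 𝟙 _) ≫ φ.map j.right.obj.hom.hom := rfl
  have h' : B.negMap ((hφ.negDown s).obj j) = φ.map (A.negMap j) :=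
    (h.trans (congrArg (· ≫ φ.map j.right.obj.hom.hom) (Category.comp_id _))).trans
      (φ.map_comp _ _).symm
  exact congrArg (fun t => Z.map t) h'

variable (hopf : IsDiscreteOpfibration φ)

include hopf

theorem negDown_induction
    {P : StructuredArrow ((hφ.mapGrpd n).obj s) (B.negDom n) → Prop}
    (hP : ∀ ⦃d d'⦄ (_ : d ⟶ d'), P d → P d') (h : ∀ j, P ((hφ.negDown s).obj j))
    (d : StructuredArrow ((hφ.mapGrpd n).obj s) (B.negDom n)) : P d := by
  have : (hφ.negDown s).IsEquivalence := hφ.isEquivalence_negSquare hopf s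
  exact hP ((hφ.negDown s).objObjPreimageIso d).hom (h _)

/-- A compatible family is a cone, and cones extend along initial functors, in particular along the
equivalence `negDown`. -/
theorem exists_negDown_extension {Z : R ⥤ SSet.{u}} {V : SSet.{u}}
    (c : ∀ j : StructuredArrow s (A.negDom n), V ⟶ Z.obj (φ.obj (A.negObj j)))
    (hc : ∀ ⦃j k : StructuredArrow s (A.negDom n)⦄ (m : j ⟶ k),
      c j ≫ Z.map (φ.map (A.negObjMap m)) = c k) :
    ∃ c' : ∀ d : StructuredArrow ((hφ.mapGrpd n).obj s) (B.negDom n), V ⟶ Z.obj (B.negObj d),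
      (∀ ⦃d e : StructuredArrow ((hφ.mapGrpd n).obj s) (B.negDom n)⦄ (m : d ⟶ e),
        c' d ≫ Z.map (B.negObjMap m) = c' e) ∧ ∀ j, c' ((hφ.negDown s).obj j) = c j := by
  have : (hφ.negDown s).IsEquivalence := hφ.isEquivalence_negSquare hopf s
  let G := StructuredArrow.proj ((hφ.mapGrpd n).obj s) (B.negDom n) ⋙ B.negCod n ⋙ Z
  let K : Cone (hφ.negDown s ⋙ G) :=
    { pt := V, π := { app := c, naturality _ _ m := (Category.id_comp _).trans (hc m).symm } }
  let K' := Functor.Initial.extendCone.obj K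
  refine ⟨fun d => K'.π.app d, fun d e m => K'.w m, fun j => ?_⟩
  refine (Functor.Initial.extendCone_obj_π_app' (F := hφ.negDown s) K (𝟙 _)).trans ?_
  exact (congrArg (c j ≫ ·) (G.map_id _)).trans (Category.comp_id _)

theorem matchingLift_mapGrpd_iff {Z W : R ⥤ SSet.{u}} (f : Z ⟶ W) {U V : SSet.{u}} (i : U ⟶ V)
    (b : V ⟶ W.obj (φ.obj s.obj.of)) :
    B.MatchingLift f ((hφ.mapGrpd n).obj s) i b ↔
      ∀ (a : U ⟶ Z.obj (φ.obj s.obj.of))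
        (c : ∀ j : StructuredArrow s (A.negDom n), V ⟶ Z.obj (φ.obj (A.negObj j))),
        (∀ ⦃j k : StructuredArrow s (A.negDom n)⦄ (m : j ⟶ k),
          c j ≫ Z.map (φ.map (A.negObjMap m)) = c k) →
        i ≫ b = a ≫ f.app (φ.obj s.obj.of) →
        (∀ j, i ≫ c j = a ≫ Z.map (φ.map (A.negMap j))) →
        (∀ j, c j ≫ f.app _ = b ≫ W.map (φ.map (A.negMap j))) →
        ∃ l : V ⟶ Z.obj (φ.obj s.obj.of), i ≫ l = a ∧ l ≫ f.app (φ.obj s.obj.of) = b ∧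
          ∀ j, l ≫ Z.map (φ.map (A.negMap j)) = c j := by
  constructor
  · intro H a c hc h₁ h₂ h₃
    obtain ⟨c', hc', hcc'⟩ := hφ.exists_negDown_extension hopf c hc
    obtain ⟨l, e₁, e₂, e₃⟩ := H a c' hc' h₁
      (hφ.negDown_induction hopf (fun d d' m h => by
          rw [← hc' m, reassoc_of% h, ← B.negMap_comp m, Functor.map_comp]
          exact Category.assoc _ _ _)
        fun j => (congrArg (i ≫ ·) (hcc' j)).trans
          ((h₂ j).trans (congrArg (a ≫ ·) (map_negMap_negDown hφ Z j).symm)))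
      (hφ.negDown_induction hopf (fun d d' m h => by
          have := f.naturality (B.negObjMap m)
          rw [← hc' m, Category.assoc, this, reassoc_of% h, ← B.negMap_comp m,
            Functor.map_comp]
          exact Category.assoc _ _ _)
        fun j => (congrArg (· ≫ f.app (φ.obj (A.negObj j))) (hcc' j)).trans
          ((h₃ j).trans (congrArg (b ≫ ·) (map_negMap_negDown hφ W j).symm)))
    exact ⟨l, e₁, e₂, fun j => (congrArg (l ≫ ·) (map_negMap_negDown hφ Z j).symm).trans
      ((e₃ _).trans (hcc' j))⟩
  · intro H a c hc h₁ h₂ h₃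
    obtain ⟨l, e₁, e₂, e₃⟩ := H a (fun j => c ((hφ.negDown s).obj j))
      (fun j k m => hc ((hφ.negDown s).map m)) h₁
      (fun j => (h₂ _).trans (congrArg (a ≫ ·) (map_negMap_negDown hφ Z j)))
      (fun j => (h₃ _).trans (congrArg (b ≫ ·) (map_negMap_negDown hφ W j)))
    refine ⟨l, e₁, e₂, hφ.negDown_induction hopf (fun d d' m h => ?_)
      fun j => (congrArg (l ≫ ·) (map_negMap_negDown hφ Z j)).trans (e₃ j)⟩
    rw [← hc m, ← h, ← B.negMap_comp m, Functor.map_comp]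
    exact (Category.assoc _ _ _).symm

/-- Fixing the base in the summand `Y s` places all the data over summands of `φ_! Y`; cartesian
units then lift them to `X`, and monicity of the units cancels them from the equations. -/
theorem matchingLift_lan_iff {X Y : S ⥤ SSet.{u}} (g : X ⟶ Y) {U V : SSet.{u}} (i : U ⟶ V)
    (b : V ⟶ Y.obj s.obj.of) :
    B.MatchingLift (φ.lan.map g) ((hφ.mapGrpd n).obj s) i (b ≫ φ.lanι Y s.obj.of) ↔
      A.MatchingLift g s i b := by
  have hpb (t : S) : IsPullback (φ.lanι X t) (g.app t) ((φ.lan.map g).app (φ.obj t))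
      (φ.lanι Y t) := hopf.isPullback_lanUnit_app g t
  have hmono (t : S) : Mono (φ.lanι X t) := hopf.mono_lanUnit_app X t
  refine (hφ.matchingLift_mapGrpd_iff hopf (φ.lan.map g) i (b ≫ φ.lanι Y s.obj.of)).trans ?_
  constructor
  · intro H a c hc h₁ h₂ h₃
    obtain ⟨l', e₁, e₂, e₃⟩ := H (a ≫ φ.lanι X _) (fun j => c j ≫ φ.lanι X (A.negObj j))
      (fun j k m => by rw [Category.assoc, φ.lanι_comp_map, ← hc m, Category.assoc])
      (by rw [Category.assoc, φ.lanι_comp_lan_map, reassoc_of% h₁])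
      (fun j => by rw [Category.assoc, φ.lanι_comp_map, reassoc_of% (h₂ j)])
      (fun j => by
        rw [Category.assoc, Category.assoc, φ.lanι_comp_map, φ.lanι_comp_lan_map,
          reassoc_of% (h₃ j)])
    refine ⟨(hpb s.obj.of).lift l' b e₂, (hpb s.obj.of).hom_ext ?_ ?_, (hpb _).lift_snd _ _ _,
      fun j => ?_⟩
    · rw [Category.assoc, IsPullback.lift_fst, e₁]
    · rw [Category.assoc, IsPullback.lift_snd, h₁]
    · rw [← cancel_mono (φ.lanι X (A.negObj j)), ← e₃ j, Category.assoc, ← φ.lanι_comp_map,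
        IsPullback.lift_fst_assoc]
  · intro H a' d hd h₁ h₂ h₃
    have h₁' : a' ≫ (φ.lan.map g).app (φ.obj s.obj.of) = (i ≫ b) ≫ φ.lanι Y s.obj.of := by
      rw [← h₁, Category.assoc]
    -- `d j` lies over the summand at `A.negObj j` because the base lies in the one at `s`.
    have h₃' (j) : d j ≫ (φ.lan.map g).app (φ.obj (A.negObj j)) =
        (b ≫ Y.map (A.negMap j)) ≫ φ.lanι Y _ := by
      rw [h₃, Category.assoc, Category.assoc, φ.lanι_comp_map]
    obtain ⟨a, ha, ha'⟩ : ∃ a, a ≫ φ.lanι X _ = a' ∧ a ≫ g.app s.obj.of = i ≫ b :=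
      ⟨_, (hpb _).lift_fst _ _ h₁', (hpb _).lift_snd _ _ h₁'⟩
    choose c hc hc' using fun j => show ∃ c, c ≫ φ.lanι X _ = d j ∧ c ≫ g.app (A.negObj j) = _ from
      ⟨_, (hpb _).lift_fst _ _ (h₃' j), (hpb _).lift_snd _ _ (h₃' j)⟩
    obtain ⟨l, e₁, e₂, e₃⟩ := H a c
      (fun j k m => by
        rw [← cancel_mono (φ.lanι X (A.negObj k)), Category.assoc, ← φ.lanι_comp_map,
          reassoc_of% (hc j), hc k, hd m])
      ha'.symm
      (fun j => by
        rw [← cancel_mono (φ.lanι X (A.negObj j)), Category.assoc, Category.assoc,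
          ← φ.lanι_comp_map, reassoc_of% ha, hc, h₂])
      hc'
    refine ⟨l ≫ φ.lanι X _, ?_, ?_, fun j => ?_⟩
    · rw [reassoc_of% e₁, ha]
    · rw [Category.assoc, φ.lanι_comp_lan_map, reassoc_of% e₂]
    · rw [Category.assoc, φ.lanι_comp_map, reassoc_of% (e₃ j), hc]

-- From `R` to `S`, it suffices to test on bases passing through the unit at `s`. From `S` to `R`,
-- the base is a simplex, hence passes through the unit at some object of the fibre.
include hφ in
theorem reedyFibrations_lan_iff {F G : S ⥤ SSet.{u}} (g : F ⟶ G) :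
    B.reedyFibrations (φ.lan.map g) ↔ A.reedyFibrations g := by
  constructor
  · intro H n s U V i hi
    rw [GeneralizedReedy.hasLiftingProperty_relMatchingMap_iff]
    intro b
    rw [← hφ.matchingLift_lan_iff hopf]
    exact (B.hasLiftingProperty_relMatchingMap_iff _ _ i).1 (H n _ i hi) _
  · intro H n x U V i hi
    rw [GeneralizedReedy.hasLiftingProperty_relMatchingMap_iff]
    intro b
    obtain ⟨m, ⟨k⟩⟩ := (MorphismProperty.iSup_iff _ _).1 hi
    have key (r : R) (b : (SSet.stdSimplex.obj (SimplexCategory.mk (m + 1)) : SSet.{u}) ⟶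
        (φ.lan.obj G).obj r) : ∀ hr : B.deg r = n,
        B.MatchingLift (φ.lan.map g) (⟨⟨r⟩, hr⟩ : B.Grpd n) (SSet.horn (m + 1) k).ι b := by
      induction b using hopf.exists_stdSimplex_fac with
      | H s b =>
        intro hr
        let s' : A.Grpd n := ⟨⟨s⟩, (hφ.map_deg s).symm.trans hr⟩
        exact (hφ.matchingLift_lan_iff hopf (s := s') g _ b).2
          ((A.hasLiftingProperty_relMatchingMap_iff g s' _).1 (H n s' _ hi) b)
    exact key _ b x.property

end IsReedyFunctor

theorem mainTheorem12 {S R : Type u} [SmallCategory S] [SmallCategory R]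
    (A : GeneralizedReedy S) (B : GeneralizedReedy R) (φ : S ⥤ R)
    (hφ : IsReedyFunctor A B φ) (hopf : IsDiscreteOpfibration φ)
    (hrefl : ReflectsMaps A.pos B.pos φ ∨ ReflectsMaps A.neg B.neg φ)
    {X Y : S ⥤ SSet.{u}} (g : X ⟶ Y) :
    (A.reedyFibrations g ↔ B.reedyFibrations (φ.lan.map g)) ∧
    (A.reedyCofibrations g ↔ B.reedyCofibrations (φ.lan.map g)) ∧
    (A.reedyWeakEquivalences g ↔ B.reedyWeakEquivalences (φ.lan.map g)) :=
  ⟨(hφ.reedyFibrations_lan_iff hopf g).symm, (hφ.reedyCofibrations_lan_iff hopf g).symm,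
    (hopf.weakEquivalences_lan_map_iff g).symm⟩
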